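/- \textbf{Setting.} Let $\eta=\mathrm{diag}(1,-1,-1,-1)$ and let $\mathcal A$ be the free graded-commutative complex algebra generated by the even variables $h_{\mu\nu}=h_{\nu\mu}$, the odd variables $u_\mu,\tilde u_\mu$ ($\mu,\nu=0,\dots,3$) and all their formal derivatives, modulo the equations of motion (every generator $\xi$ satisfies $\eta^{\mu\nu}d_\mu d_\nu\xi=0$). Thus $\mathcal A$ is the algebra of Wick polynomials in the massless free fields $h,u,\tilde u$. Let $d_\mu$ be the formal derivatives, and let $d_Q$ be the odd derivation of $\mathcal A$ commuting with the $d_\mu$ with $$d_Qh_{\mu\nu}=-\tfrac i2\,(d_\mu u_\nu+d_\nu u_\mu-\eta_{\mu\nu}\,d_\rho u^\rho),\qquad d_Qu_\rho=0,\qquad d_Q\tilde u_\sigma=i\,d^\lambda h_{\sigma\lambda}.$$ The ghost number $gh$ is $0,1,-1$ for $h,u,\tilde u$; the degree of a monomial is its number of field factors; its canonical dimension $\omega$ is the number of field factors plus the number of derivatives. A \emph{cochain} $R$ assigns to each pair of Lorentz multi-indices $I,J$ a quasi-local expression $R(T^I(x_1),T^J(x_2))=\sum_k\partial^k\delta(x_1-x_2)\,W_k(x_2)$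 (a finite sum, $W_k\in\mathcal A$). On these, $\partial^1_\mu=\partial/\partial x_1^\mu$ acts on the delta function only, $\partial^2_\mu=\partial/\partial x_2^\mu$ acts on both factors, and $d_Q$ acts on the $W_k$. Put $$(\delta R)(T^I,T^J)=\partial^1_\mu R(T^{I\mu},T^J)+(-1)^{|I|}\,\partial^2_\mu R(T^I,T^{J\mu}),\qquad s=d_Q-i\delta,\qquad \bar s=d_Q+i\delta .$$ A \emph{cocycle} is a cochain with $sR=0$ (for all $I,J$); two cochains are \emph{cohomologous} if their difference is a coboundary $\bar sB$. Fix a set $D\subseteq\mathbb N$ of degrees (for instance $D=\{4\}$, the quadri-linear sector, or $D=\mathbb N$). For integers $g,w$, call a cochain $$R(T^I(x_1),T^J(x_2))=\delta(x_1-x_2)N(T^I,T^J)(x_2)+\partial_\mu\delta(x_1-x_2)N(T^I,T^J)^\mu(x_2)+\partial_\mu\partial_\nu\delta(x_1-x_2)N(T^I,T^J)^{\mu\nu}(x_2)$$ \emph{admissible of type $(g,w)$} if the coefficients $N$ are completely antisymmetric in $I$ and in $J$, $N^{\mu\nu}$ is symmetric in $\mu\nu$, all coefficients are covariant under the proper orthochronous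 Lorentz group, all their monomials have degree in $D$, $gh(N(T^I,T^J)^{\dots})=g+|I|+|J|$, and $\omega(N)\le w$, $\omega(N^\mu)\le w-1$, $\omega(N^{\mu\nu})\le w-2$. \textbf{Theorem.} Let $R$ be an admissible cochain of type $(0,6)$ with $sR=0$. Then $R$ is cohomologous to a cocycle $R'$ that is admissible of type $(0,6)$ and has $N'(T^I,T^J)^{\mu\nu}=0$ for all $I,J$. More precisely, $R-R'=\bar sB$ with $B$ admissible of type $(-1,5)$ and without the $\partial\partial\delta$ term. If moreover $R$ has the graded symmetry $R(T^I(x_1),T^J(x_2))=(-1)^{|I||J|}R(T^J(x_2),T^I(x_1))$, then $R'$ and $B$ can be chosen with the same symmetry. -/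

import Mathlib

namespace CausalGravity

noncomputable section

open MvPolynomial Matrix

/-! ### Minkowski space and the jet variables of linearized gravity -/

/-- The Minkowski metric `diag(1,-1,-1,-1)`; numerically it equals its own inverse. -/
def eta : Matrix (Fin 4) (Fin 4) ℝ := Matrix.diagonal ![1, -1, -1, -1]

/-- The basic fields, with lower Lorentz indices: the graviton `h_{μν}`, the ghost `u_μ` and the
anti-ghost `ũ_μ`. -/
inductive GField : Type
  | h (μ ν : Fin 4) : GField
  | u (μ : Fin 4) : GField
  | ut (μ : Fin 4) : GField

/-- Grassmann parity (`true` for odd). -/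
def GField.odd : GField → Bool
  | .h _ _ => false
  | .u _ => true
  | .ut _ => true

/-- Ghost number of the basic fields. -/
def GField.gh : GField → ℤ
  | .h _ _ => 0
  | .u _ => 1
  | .ut _ => -1

/-- Polynomials in the formal partial derivatives; `X μ` stands for `d_μ`. -/
abbrev DPoly : Type := MvPolynomial (Fin 4) ℂ

/-- The linear space spanned by the fields and their formal derivatives:
`Finsupp.single a P` stands for `P(d) ξ_a`. -/
abbrev Jet : Type := GField →₀ DPoly

/-- Jets of definite Grassmann parity. -/
def HasParity (p : Bool) (x : Jet) : Prop := ∀ a : GField, x a ≠ 0 → a.odd = p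

/-- The sign `(-1)^{|p||q|}`. -/
def sgn (p q : Bool) : ℂ := if p && q then -1 else 1

/-- The wave operator `η^{μν} d_μ d_ν`. -/
def box : DPoly := ∑ μ, ∑ ν, C (eta μ ν : ℂ) * (X μ * X ν)

/-- The relations of the on-shell polynomial algebra: the (Klein-Gordon) equations of motion,
the symmetry of `h_{μν}` and graded commutativity. -/
inductive Rel : TensorAlgebra ℂ Jet → TensorAlgebra ℂ Jet → Prop
  | eom (x : Jet) : Rel (TensorAlgebra.ι ℂ (box • x)) 0
  | symm (μ ν : Fin 4) (P : DPoly) :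
      Rel (TensorAlgebra.ι ℂ (Finsupp.single (GField.h μ ν) P))
        (TensorAlgebra.ι ℂ (Finsupp.single (GField.h ν μ) P))
  | scomm (p q : Bool) (x y : Jet) (hx : HasParity p x) (hy : HasParity q y) :
      Rel (TensorAlgebra.ι ℂ x * TensorAlgebra.ι ℂ y)
        (sgn p q • (TensorAlgebra.ι ℂ y * TensorAlgebra.ι ℂ x))

/-- The graded-commutative algebra of polynomials in the massless free fields and their
derivatives, i.e. the algebra of (classical labels of) Wick polynomials. -/
def Alg : Type := RingQuot Rel

instance : Ring Alg := inferInstanceAs (Ring (RingQuot Rel))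

instance : Algebra ℂ Alg := inferInstanceAs (Algebra ℂ (RingQuot Rel))

/-- The quotient map. -/
def toAlg : TensorAlgebra ℂ Jet →ₐ[ℂ] Alg := RingQuot.mkAlgHom ℂ Rel

theorem toAlg_rel {a b : TensorAlgebra ℂ Jet} (h : Rel a b) : toAlg a = toAlg b :=
  RingQuot.mkAlgHom_rel ℂ h

/-- A jet, seen as a linear Wick polynomial. -/
def xi : Jet →ₗ[ℂ] Alg := toAlg.toLinearMap ∘ₗ TensorAlgebra.ι ℂ

theorem xi_eom (x : Jet) : xi (box • x) = 0 := by
  have := toAlg_rel (Rel.eom x)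
  simpa [xi] using this

theorem xi_symm (μ ν : Fin 4) (P : DPoly) :
    xi (Finsupp.single (GField.h μ ν) P) = xi (Finsupp.single (GField.h ν μ) P) :=
  toAlg_rel (Rel.symm μ ν P)

theorem xi_scomm (p q : Bool) (x y : Jet) (hx : HasParity p x) (hy : HasParity q y) :
    xi x * xi y = sgn p q • (xi y * xi x) := by
  have := toAlg_rel (Rel.scomm p q x y hx hy)
  simpa [xi] using this

/-- Extension of a linear map on jets that respects the relations to an algebra morphism. -/
def liftAlg {B : Type*} [Ring B] [Algebra ℂ B] (f : Jet →ₗ[ℂ] B)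
    (h₁ : ∀ x, f (box • x) = 0)
    (h₂ : ∀ μ ν P, f (Finsupp.single (GField.h μ ν) P) = f (Finsupp.single (GField.h ν μ) P))
    (h₃ : ∀ p q x y, HasParity p x → HasParity q y → f x * f y = sgn p q • (f y * f x)) :
    Alg →ₐ[ℂ] B :=
  RingQuot.liftAlgHom ℂ ⟨TensorAlgebra.lift ℂ f, by
    intro a b hab
    cases hab with
    | eom x => simpa using h₁ x
    | symm μ ν P => simpa using h₂ μ ν P
    | scomm p q x y hx hy => simpa using h₃ p q x y hx hy⟩

/-! ### Graded derivations -/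

theorem HasParity.smul {p : Bool} {x : Jet} (hx : HasParity p x) (P : DPoly) :
    HasParity p (P • x) := by
  intro a ha
  apply hx a
  intro h0
  apply ha
  simp [h0]

theorem HasParity.add {p : Bool} {x y : Jet} (hx : HasParity p x) (hy : HasParity p y) :
    HasParity p (x + y) := by
  intro a ha
  by_cases h : x a = 0
  · apply hy a
    intro h0
    apply ha
    simp [h, h0]
  · exact hx a h

theorem HasParity.zero (p : Bool) : HasParity p 0 := fun _ ha => absurd rfl ha

theorem HasParity.sum {ι : Type*} {p : Bool} (s : Finset ι) {f : ι → Jet}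
    (hf : ∀ i ∈ s, HasParity p (f i)) : HasParity p (∑ i ∈ s, f i) :=
  Finset.sum_induction f (HasParity p) (fun _ _ => HasParity.add) (HasParity.zero p) hf

theorem HasParity.single (a : GField) (P : DPoly) : HasParity a.odd (Finsupp.single a P) := by
  classical
  intro b hb
  rw [Finsupp.single_apply] at hb
  split_ifs at hb with h
  · rw [h]
  · exact absurd rfl hb

/-- A map given on the basic fields and `d`-linear, of parity `e`, has parity `e` on jets. -/
theorem HasParity.linearCombination {e p : Bool} {v : GField → Jet}
    (hv : ∀ a, HasParity (xor e a.odd) (v a)) {x : Jet} (hx : HasParity p x) :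
    HasParity (xor e p) (Finsupp.linearCombination DPoly v x) := by
  rw [Finsupp.linearCombination_apply, Finsupp.sum]
  apply HasParity.sum
  intro a ha
  have h1 := hx a (Finsupp.mem_support_iff.mp ha)
  have h2 := (hv a).smul (x a)
  rwa [h1] at h2

/-- The involution `x ↦ (-1)^{|e||x|} x`. -/
def twist (e : Bool) : Jet →ₗ[DPoly] Jet :=
  Finsupp.linearCombination DPoly fun a => Finsupp.single a (C (sgn e a.odd))

theorem twist_apply {e p : Bool} {x : Jet} (hx : HasParity p x) :
    twist e x = sgn e p • x := by
  rw [twist, Finsupp.linearCombination_apply, Finsupp.sum]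
  conv_rhs => rw [← Finsupp.sum_single x, Finsupp.sum, Finset.smul_sum]
  refine Finset.sum_congr rfl fun a ha => ?_
  have h1 := hx a (Finsupp.mem_support_iff.mp ha)
  rw [h1, Finsupp.smul_single, Finsupp.smul_single, smul_eq_mul, mul_comm, MvPolynomial.smul_eq_C_mul]

/-- The algebra morphism `x ↦ [[(-1)^{|e||x|} x, D x], [0, x]]` whose off-diagonal entry is the
graded derivation of parity `e` that extends `D`. -/
def derHom (e : Bool) (D : Jet →ₗ[DPoly] Jet)
    (hD : ∀ p x, HasParity p x → HasParity (xor e p) (D x))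
    (hs : ∀ μ ν P, xi (D (Finsupp.single (GField.h μ ν) P)) =
      xi (D (Finsupp.single (GField.h ν μ) P))) :
    Alg →ₐ[ℂ] Matrix (Fin 2) (Fin 2) Alg :=
  liftAlg
    { toFun := fun x => !![xi (twist e x), xi (D x); 0, xi x]
      map_add' := by
        intro x y
        ext i j
        fin_cases i <;> fin_cases j <;> simp
      map_smul' := by
        intro c x
        have h (E : Jet →ₗ[DPoly] Jet) : xi (E (c • x)) = c • xi (E x) := by
          rw [← map_smul xi, ← LinearMap.map_smul_of_tower]
        ext i j
        fin_cases i <;> fin_cases j <;> simp [h, -LinearMap.map_smul_of_tower] }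
    (by
      intro x
      simp only [LinearMap.coe_mk, AddHom.coe_mk, LinearMap.map_smul, xi_eom]
      ext i j
      fin_cases i <;> fin_cases j <;> rfl)
    (by
      intro μ ν P
      have h (ρ σ : Fin 4) : xi (twist e (Finsupp.single (GField.h ρ σ) P)) =
          sgn e false • xi (Finsupp.single (GField.h ρ σ) P) := by
        rw [twist_apply (p := false) (HasParity.single (GField.h ρ σ) P), map_smul]
      simp only [LinearMap.coe_mk, AddHom.coe_mk]
      rw [h, h, hs μ ν P, xi_symm μ ν P])
    (by
      intro p q x y hx hy
      have a1 := xi_scomm p q x y hx hy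
      have a2 := xi_scomm (xor e p) q (D x) y (hD p x hx) hy
      have a3 := xi_scomm p (xor e q) x (D y) hx (hD q y hy)
      have e1 : sgn e q * (sgn e p * sgn p q) = sgn p q * (sgn e p * sgn e q) := by ring
      have e2 : sgn e p * sgn p (xor e q) = sgn p q := by
        cases e <;> cases p <;> cases q <;> simp [sgn]
      have e3 : sgn (xor e p) q = sgn p q * sgn e q := by
        cases e <;> cases p <;> cases q <;> simp [sgn]
      simp only [LinearMap.coe_mk, AddHom.coe_mk, twist_apply hx, twist_apply hy, map_smul,
        Matrix.mul_fin_two, Matrix.smul_of, Matrix.smul_cons, Matrix.smul_empty, mul_zero,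
        zero_mul, add_zero, zero_add, smul_zero, smul_mul_assoc, mul_smul_comm, a1, a2, a3,
        smul_smul, smul_add, e1, e2, e3]
      rw [add_comm (sgn p q • (xi (D y) * xi x))])

/-- The graded derivation of parity `e` of the algebra that extends `D`. -/
def gradedDer (e : Bool) (D : Jet →ₗ[DPoly] Jet)
    (hD : ∀ p x, HasParity p x → HasParity (xor e p) (D x))
    (hs : ∀ μ ν P, xi (D (Finsupp.single (GField.h μ ν) P)) =
      xi (D (Finsupp.single (GField.h ν μ) P))) : Alg →ₗ[ℂ] Alg :=
  Matrix.entryLinearMap ℂ Alg 0 1 ∘ₗ (derHom e D hD hs).toLinearMap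

/-- The formal derivative `d_μ`. -/
def d (μ : Fin 4) : Alg →ₗ[ℂ] Alg :=
  gradedDer false ((X μ : DPoly) • LinearMap.id)
    (fun p x hx => by simpa using hx.smul (X μ))
    (fun ρ σ P => by
      simp only [LinearMap.smul_apply, LinearMap.id_apply]
      rw [Finsupp.smul_single, Finsupp.smul_single]
      exact xi_symm ρ σ _)

/-- The gauge charge on the basic fields:
`d_Q h_{μν} = -(i/2)(d_μ u_ν + d_ν u_μ - η_{μν} d_ρ u^ρ)`, `d_Q u_ρ = 0`,
`d_Q ũ_σ = i d^λ h_{σλ}`. -/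
def gauge : GField → Jet
  | .h μ ν => (C (-Complex.I / 2) : DPoly) •
      (Finsupp.single (GField.u ν) (X μ) + Finsupp.single (GField.u μ) (X ν) +
        (C (-(eta μ ν : ℂ)) : DPoly) •
          ∑ ρ, ∑ σ, Finsupp.single (GField.u σ) (C (eta ρ σ : ℂ) * X ρ))
  | .u _ => 0
  | .ut σ => (C Complex.I : DPoly) •
      ∑ lam, ∑ κ, Finsupp.single (GField.h σ lam) (C (eta lam κ : ℂ) * X κ)

theorem gauge_parity (a : GField) : HasParity (xor true a.odd) (gauge a) := by
  cases a with
  | h μ ν =>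
    exact (((HasParity.single (GField.u ν) _).add (HasParity.single (GField.u μ) _)).add
      ((HasParity.sum _ fun ρ _ => HasParity.sum _ fun σ _ =>
        HasParity.single (GField.u σ) _).smul _)).smul _
  | u μ => exact HasParity.zero _
  | ut σ =>
    exact (HasParity.sum _ fun lam _ => HasParity.sum _ fun κ _ =>
      HasParity.single (GField.h σ lam) _).smul _

theorem eta_symm (μ ν : Fin 4) : eta μ ν = eta ν μ := by
  by_cases h : μ = ν
  · rw [h]
  · simp [eta, Matrix.diagonal_apply_ne _ h, Matrix.diagonal_apply_ne _ (Ne.symm h)]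

/-- The gauge charge `d_Q`: the odd derivation that commutes with all `d_μ` and is given by
`gauge` on the basic fields. -/
def dQ : Alg →ₗ[ℂ] Alg :=
  gradedDer true (Finsupp.linearCombination DPoly gauge)
    (fun _ _ hx => HasParity.linearCombination gauge_parity hx)
    (fun μ ν P => by
      have h : gauge (GField.h μ ν) = gauge (GField.h ν μ) := by
        simp only [gauge, eta_symm μ ν]
        rw [add_comm (Finsupp.single (GField.u ν) (X μ))]
      simp [Finsupp.linearCombination_single, h])

/-! ### Lorentz transformations -/

/-- The proper orthochronous Lorentz group. -/
def IsLorentz (Λ : Matrix (Fin 4) (Fin 4) ℝ) : Prop :=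
  Λᵀ * eta * Λ = eta ∧ Λ.det = 1 ∧ 0 < Λ 0 0

/-- The matrix `η Λ η` by which lower indices transform when upper ones transform by `Λ`. -/
def low (Λ : Matrix (Fin 4) (Fin 4) ℝ) : Matrix (Fin 4) (Fin 4) ℝ := eta * Λ * eta

/-- Lorentz transformation of polynomials in the derivatives: `d_μ ↦ ∑ (ηΛη)_{μα} d_α`. -/
def actD (Λ : Matrix (Fin 4) (Fin 4) ℝ) : DPoly →ₐ[ℂ] DPoly :=
  aeval fun μ => ∑ α, C (low Λ μ α : ℂ) * X α

/-- Lorentz transformation of the basic fields. -/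
def actField (Λ : Matrix (Fin 4) (Fin 4) ℝ) : GField → Jet
  | .h μ ν => ∑ α, ∑ β, Finsupp.single (GField.h α β) (C (low Λ μ α * low Λ ν β : ℂ))
  | .u μ => ∑ α, Finsupp.single (GField.u α) (C (low Λ μ α : ℂ))
  | .ut μ => ∑ α, Finsupp.single (GField.ut α) (C (low Λ μ α : ℂ))

/-- Lorentz transformation of jets. -/
def actJet (Λ : Matrix (Fin 4) (Fin 4) ℝ) : Jet →ₗ[ℂ] Jet :=
  Finsupp.lsum ℂ fun a =>
    ((LinearMap.toSpanSingleton DPoly Jet (actField Λ a)).restrictScalars ℂ) ∘ₗ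
      (actD Λ).toLinearMap

theorem actJet_apply (Λ : Matrix (Fin 4) (Fin 4) ℝ) (x : Jet) :
    actJet Λ x = ∑ a ∈ x.support, actD Λ (x a) • actField Λ a := by
  simp [actJet, Finsupp.lsum_apply, Finsupp.sum]

theorem actJet_single (Λ : Matrix (Fin 4) (Fin 4) ℝ) (a : GField) (P : DPoly) :
    actJet Λ (Finsupp.single a P) = actD Λ P • actField Λ a := by
  simp [actJet]

theorem actJet_smul (Λ : Matrix (Fin 4) (Fin 4) ℝ) (P : DPoly) (x : Jet) :
    actJet Λ (P • x) = actD Λ P • actJet Λ x := by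
  induction x using Finsupp.induction_linear with
  | zero => simp
  | add x y hx hy => simp [smul_add, hx, hy]
  | single a Q =>
    rw [Finsupp.smul_single, actJet_single, actJet_single, smul_eq_mul, map_mul, mul_smul]

theorem actJet_parity (Λ : Matrix (Fin 4) (Fin 4) ℝ) {p : Bool} {x : Jet}
    (hx : HasParity p x) : HasParity p (actJet Λ x) := by
  have key (a : GField) : HasParity a.odd (actField Λ a) := by
    cases a with
    | h μ ν => exact HasParity.sum _ fun α _ => HasParity.sum _ fun β _ =>
        HasParity.single (GField.h α β) _
    | u μ => exact HasParity.sum _ fun α _ => HasParity.single (GField.u α) _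
    | ut μ => exact HasParity.sum _ fun α _ => HasParity.single (GField.ut α) _
  rw [actJet_apply]
  apply HasParity.sum
  intro a ha
  have h1 := hx a (Finsupp.mem_support_iff.mp ha)
  have h2 := (key a).smul (actD Λ (x a))
  rwa [h1] at h2

theorem eta_mul_eta : eta * eta = 1 := by
  rw [eta, Matrix.diagonal_mul_diagonal, ← Matrix.diagonal_one]
  congr 1
  funext i
  fin_cases i <;> simp

theorem low_isometry {Λ : Matrix (Fin 4) (Fin 4) ℝ} (hΛ : IsLorentz Λ) :
    (low Λ)ᵀ * eta * low Λ = eta := by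
  have ht : etaᵀ = eta := by simp [eta]
  calc (low Λ)ᵀ * eta * low Λ = eta * (Λᵀ * (eta * eta * eta) * Λ) * eta := by
        simp only [low, Matrix.transpose_mul, ht, Matrix.mul_assoc]
    _ = eta * (Λᵀ * eta * Λ) * eta := by rw [eta_mul_eta, Matrix.one_mul]
    _ = eta := by rw [hΛ.1, eta_mul_eta, Matrix.one_mul]

theorem actD_box {Λ : Matrix (Fin 4) (Fin 4) ℝ} (hΛ : IsLorentz Λ) : actD Λ box = box := by
  have h (α β : Fin 4) : ∑ μ, ∑ ν, low Λ μ α * eta μ ν * low Λ ν β = eta α β := by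
    have := congrFun (congrFun (low_isometry hΛ) α) β
    rw [← this, Matrix.mul_apply, Finset.sum_comm]
    refine Finset.sum_congr rfl fun ν _ => ?_
    rw [Matrix.mul_apply, Finset.sum_mul]
    rfl
  have hC (α β : Fin 4) : (C (eta α β : ℂ) : DPoly) =
      ∑ μ, ∑ ν, C (low Λ μ α : ℂ) * C (eta μ ν : ℂ) * C (low Λ ν β : ℂ) := by
    rw [← h α β]
    push_cast
    simp only [map_sum, map_mul]
  calc actD Λ box
      = ∑ μ, ∑ ν, ∑ α, ∑ β, C (low Λ μ α : ℂ) * C (eta μ ν : ℂ) * C (low Λ ν β : ℂ) *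
          (X α * X β) := by
        simp only [box, actD, map_sum, map_mul, aeval_X, aeval_C, MvPolynomial.algebraMap_eq,
          Finset.sum_mul_sum]
        simp only [Finset.mul_sum]
        refine Finset.sum_congr rfl fun μ _ => Finset.sum_congr rfl fun ν _ =>
          Finset.sum_congr rfl fun α _ => Finset.sum_congr rfl fun β _ => ?_
        ring
    _ = ∑ α, ∑ β, ∑ μ, ∑ ν, C (low Λ μ α : ℂ) * C (eta μ ν : ℂ) * C (low Λ ν β : ℂ) *
          (X α * X β) := by
        rw [Finset.sum_congr rfl fun μ _ => Finset.sum_comm, Finset.sum_comm]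
        refine Finset.sum_congr rfl fun α _ => ?_
        rw [Finset.sum_congr rfl fun μ _ => Finset.sum_comm, Finset.sum_comm]
    _ = box := by
        rw [box]
        refine Finset.sum_congr rfl fun α _ => Finset.sum_congr rfl fun β _ => ?_
        rw [hC α β]
        simp only [Finset.sum_mul]

/-- The action of a Lorentz transformation on Wick polynomials. -/
def lorentz (Λ : Matrix (Fin 4) (Fin 4) ℝ) (hΛ : IsLorentz Λ) : Alg →ₐ[ℂ] Alg :=
  liftAlg (xi ∘ₗ actJet Λ)
    (fun x => by simp [actJet_smul, actD_box hΛ, xi_eom])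
    (fun μ ν P => by
      simp only [LinearMap.comp_apply, actJet_single, actField, Finset.smul_sum, map_sum,
        Finsupp.smul_single]
      rw [Finset.sum_comm]
      refine Finset.sum_congr rfl fun α _ => Finset.sum_congr rfl fun β _ => ?_
      rw [xi_symm, mul_comm (low Λ μ β : ℂ)])
    (fun p q x y hx hy => xi_scomm p q _ _ (actJet_parity Λ hx) (actJet_parity Λ hy))

/-! ### Ghost number, canonical dimension and degree -/

/-- Jet variables `ξ_{a;k}` (`k` is the multi-index of the derivatives). -/
abbrev JetVar : Type := GField × (Fin 4 →₀ ℕ)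

/-- The Wick monomial that is the product of a list of jet variables. -/
def wickMonomial (L : List JetVar) : Alg :=
  (L.map fun v => xi (Finsupp.single v.1 (MvPolynomial.monomial v.2 1))).prod

/-- The canonical dimension of a monomial: every field counts `1` and so does every derivative. -/
def omega (L : List JetVar) : ℤ := (L.map fun v => 1 + ((v.2.degree : ℕ) : ℤ)).sum

/-- The ghost number of a monomial. -/
def ghost (L : List JetVar) : ℤ := (L.map fun v => v.1.gh).sum

/-- Wick polynomials all of whose monomials have a degree (number of field factors) in `D`,
ghost number `g` and canonical dimension at most `w`. -/
def polys (D : Set ℕ) (g w : ℤ) : Submodule ℂ Alg :=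
  Submodule.span ℂ
    {A | ∃ L : List JetVar, L.length ∈ D ∧ ghost L = g ∧ omega L ≤ w ∧ A = wickMonomial L}

/-! ### Quasi-local operators -/

/-- Quasi-local expressions `∑_k ∂^k δ(x₁ - x₂) W_k(x₂)`, given by their coefficients `W_k`. -/
abbrev QuasiLocal : Type := (Fin 4 →₀ ℕ) →₀ Alg

/-- `δ(x₁ - x₂) W(x₂)`. -/
def delta : Alg →ₗ[ℂ] QuasiLocal := Finsupp.lsingle 0

/-- Action of a linear operation on the coefficients. -/
def onCoeff (f : Alg →ₗ[ℂ] Alg) : Module.End ℂ QuasiLocal := Finsupp.mapRange.linearMap f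

/-- The derivative `∂/∂x₁^μ`: it acts on the delta function only. -/
def del1 (μ : Fin 4) : Module.End ℂ QuasiLocal :=
  Finsupp.lmapDomain Alg ℂ fun k => k + Finsupp.single μ 1

/-- The derivative `∂/∂x₂^μ`: by the Leibniz rule it acts on the coefficient by `d_μ` and on the
delta function by `-∂_μ`. -/
def del2 (μ : Fin 4) : Module.End ℂ QuasiLocal := onCoeff (d μ) - del1 μ

/-- The exchange `x₁ ↔ x₂`: it fixes `δ(x₁ - x₂) W(x₂) = δ(x₂ - x₁) W(x₁)` and turns
`∂/∂x₁` into `∂/∂x₂`. -/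
def exchange : QuasiLocal →ₗ[ℂ] QuasiLocal :=
  Finsupp.lsum ℂ fun k =>
    ((List.finRange 4).map fun μ => del2 μ ^ k μ).prod ∘ₗ delta

/-! ### Cochains -/

/-- Lorentz multi-indices `I` of the expressions `T^I`. -/
abbrev Idx : Type := List (Fin 4)

/-- Cochains `(I, J) ↦ R(T^I(x₁), T^J(x₂))`. -/
abbrev Cochain : Type := Idx → Idx → QuasiLocal

/-- The operator `(δR)(T^I,T^J) = ∂^1_μ R(T^{Iμ},T^J) + (-1)^{|I|} ∂^2_μ R(T^I,T^{Jμ})`. -/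
def deltaOp (R : Cochain) : Cochain := fun I J =>
  ∑ μ, del1 μ (R (I ++ [μ]) J) + (-1 : ℂ) ^ I.length • ∑ μ, del2 μ (R I (J ++ [μ]))

/-- The cocycle operator `s = d_Q - i δ`. -/
def sOp (R : Cochain) : Cochain := fun I J =>
  onCoeff dQ (R I J) - Complex.I • deltaOp R I J

/-- The coboundary operator `s̄ = d_Q + i δ`. -/
def sBar (B : Cochain) : Cochain := fun I J =>
  onCoeff dQ (B I J) + Complex.I • deltaOp B I J

/-- The graded symmetry `R(T^I(x₁),T^J(x₂)) = (-1)^{|I||J|} R(T^J(x₂),T^I(x₁))`. -/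
def IsGradedSymmetric (R : Cochain) : Prop :=
  ∀ I J, R I J = (-1 : ℂ) ^ (I.length * J.length) • exchange (R J I)

/-- The coefficients `N(T^I,T^J)`, `N(T^I,T^J)^μ`, `N(T^I,T^J)^{μν}`. -/
structure Coeffs where
  /-- coefficient of `δ` -/
  N : Idx → Idx → Alg
  /-- coefficient of `∂_μ δ` -/
  N₁ : Idx → Idx → Fin 4 → Alg
  /-- coefficient of `∂_μ ∂_ν δ` -/
  N₂ : Idx → Idx → Fin 4 → Fin 4 → Alg

/-- The cochain `δ N + ∂_μ δ N^μ + ∂_μ ∂_ν δ N^{μν}`. -/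
def Coeffs.toCochain (c : Coeffs) : Cochain := fun I J =>
  delta (c.N I J) + ∑ μ, del1 μ (delta (c.N₁ I J μ)) +
    ∑ μ, ∑ ν, del1 μ (del1 ν (delta (c.N₂ I J μ ν)))

/-- Complete antisymmetry in a multi-index. -/
def IsSkew {V : Type*} [AddCommGroup V] (f : Idx → V) : Prop :=
  ∀ (I I' : Idx) (μ ν : Fin 4), f (I ++ μ :: ν :: I') = -f (I ++ ν :: μ :: I')

/-- `∑_{I'} Λ^{μ₁}_{α₁} ⋯ Λ^{μ_n}_{α_n} f(α₁ … α_n)` for the multi-index `μ₁ … μ_n`. -/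
def tensorAct {V : Type*} [AddCommGroup V] [Module ℂ V] (Λ : Matrix (Fin 4) (Fin 4) ℝ) :
    Idx → (Idx → V) → V
  | [], f => f []
  | μ :: I, f => ∑ α, (Λ μ α : ℂ) • tensorAct Λ I fun I' => f (α :: I')

/-- The standing requirements on the coefficients: complete antisymmetry in each of the
multi-indices `I`, `J`; symmetry of `N^{μν}` in `μν`; degrees in `D`, ghost number `g + |I| + |J|`
and power counting with bounds `w`, `w - 1`, `w - 2`; Lorentz covariance. -/
structure Coeffs.Admissible (D : Set ℕ) (g w : ℤ) (c : Coeffs) : Prop where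
  skew_left : ∀ J, IsSkew fun I => (c.N I J, c.N₁ I J, c.N₂ I J)
  skew_right : ∀ I, IsSkew fun J => (c.N I J, c.N₁ I J, c.N₂ I J)
  symm : ∀ I J μ ν, c.N₂ I J μ ν = c.N₂ I J ν μ
  mem : ∀ I J : Idx, c.N I J ∈ polys D (g + I.length + J.length) w
  mem₁ : ∀ (I J : Idx) (μ : Fin 4), c.N₁ I J μ ∈ polys D (g + I.length + J.length) (w - 1)
  mem₂ : ∀ (I J : Idx) (μ ν : Fin 4),
    c.N₂ I J μ ν ∈ polys D (g + I.length + J.length) (w - 2)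
  cov : ∀ (Λ : Matrix (Fin 4) (Fin 4) ℝ) (hΛ : IsLorentz Λ) (I J : Idx),
    lorentz Λ hΛ (c.N I J) =
      tensorAct Λ I fun I' => tensorAct Λ J fun J' => c.N I' J'
  cov₁ : ∀ (Λ : Matrix (Fin 4) (Fin 4) ℝ) (hΛ : IsLorentz Λ) (I J : Idx) (μ : Fin 4),
    lorentz Λ hΛ (c.N₁ I J μ) =
      tensorAct Λ I fun I' => tensorAct Λ J fun J' => ∑ α, (Λ μ α : ℂ) • c.N₁ I' J' α
  cov₂ : ∀ (Λ : Matrix (Fin 4) (Fin 4) ℝ) (hΛ : IsLorentz Λ) (I J : Idx) (μ ν : Fin 4),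
    lorentz Λ hΛ (c.N₂ I J μ ν) =
      tensorAct Λ I fun I' => tensorAct Λ J fun J' =>
        ∑ α, ∑ β, (Λ μ α * Λ ν β : ℂ) • c.N₂ I' J' α β

end

end CausalGravity

open CausalGravity

namespace CausalGravity

noncomputable section

open MvPolynomial Matrix

/-! ### Graded derivations of the algebra of Wick polynomials -/

/-! Everything rests on the coefficient of ∂∂∂δ in sR = 0. Neither `d_Q` nor the `d_μ` acting on
coefficients raises the order in ∂, so only N^{μν} contributes (`cocycle_leading`): the expression
N(T^{Iα},T^J)^{βγ} - (-1)^{|I|} N(T^I,T^{Jα})^{βγ}, summed over the three choices of α among the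
symmetric indices, vanishes. As N^{μν} is skew in I and in J, it is a form in two sets of odd
variables with values in quadratic polynomials in ∂. The bracket is a contraction ι_α (`contr`), and
the equation is the cycle condition of a Koszul complex. For B = ∂_νδ B^ν the leading coefficient of
s̄B is, up to the factor i/2, the symmetrized contraction of B^ν (`symmFamily_barFamily`). So N^{μν}
can be removed because this complex is exact in polynomial degree two (`contr_koszulPrimitive`).

The homotopy h multiplies by ε_ρ in the I-variables (`wedge`) and contracts ρ with a tensor index.
From ι_μ ε_ρ + ε_ρ ι_μ = δ_{μρ} (`contr_wedge`), a cycle g satisfies ∂hg = (2 + n)g with n = ∑_ρ ε_ρ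
ι_ρ. The operator n is |I| minus a part that sees only shorter I, so 2 + n is inverted by recursion
on |I| (`koszulInv`). Since ι_μ n = (n + 1) ι_μ (`contr_koszulNumber`), the boundary of (2 + n)⁻¹ f
is killed by the injective operator 3 + n when f is a cycle. Hence (2 + n)⁻¹ f is a cycle too, and f
= ∂h(2 + n)⁻¹ f.

All operations involved are covariant and respect antisymmetry, degrees, ghost number and power
counting; this is the bookkeeping of `IsFamily`. Finally R' = R - s̄B is a cocycle because s s̄ =
d_Q² + i(d_Q δ - δ d_Q) + δ² = 0 (`sOp_sBar`): d_Q² vanishes on shell, δ² by antisymmetry, and d_Q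
commutes with δ. If R is graded symmetric, B is replaced by the mean of B and its flip; the flip
commutes with s̄ (`sBar_flip`), and the leading coefficient of s̄B is unaffected. -/

theorem liftAlg_xi {B : Type*} [Ring B] [Algebra ℂ B] (f : Jet →ₗ[ℂ] B) (h₁ h₂ h₃) (x : Jet) :
    liftAlg f h₁ h₂ h₃ (xi x) = f x := by
  have : liftAlg f h₁ h₂ h₃ (toAlg (TensorAlgebra.ι ℂ x)) = TensorAlgebra.lift ℂ f
      (TensorAlgebra.ι ℂ x) := RingQuot.liftAlgHom_mkAlgHom_apply ℂ _ _ _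
  simpa [xi] using this

/-- The algebra is a quotient of the tensor algebra, hence generated by the linear elements.
Identities between derivations are therefore checked on `xi x` and carried through the Leibniz rule.
-/
theorem Alg.induction {p : Alg → Prop} (scalar : ∀ r : ℂ, p (algebraMap ℂ Alg r))
    (gen : ∀ x, p (xi x)) (mul : ∀ a b, p a → p b → p (a * b))
    (add : ∀ a b, p a → p b → p (a + b)) (a : Alg) : p a := by
  obtain ⟨t, rfl⟩ : ∃ t, toAlg t = a := RingQuot.mkAlgHom_surjective ℂ Rel a
  induction t using TensorAlgebra.induction with
  | algebraMap r => rw [AlgHom.commutes]; exact scalar r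
  | ι x => exact gen x
  | mul a b ha hb => rw [map_mul]; exact mul _ _ ha hb
  | add a b ha hb => rw [map_add]; exact add _ _ ha hb

theorem algHom_ext_xi {B : Type*} [Ring B] [Algebra ℂ B] {f g : Alg →ₐ[ℂ] B}
    (h : ∀ x, f (xi x) = g (xi x)) : f = g := by
  ext a
  induction a using Alg.induction with
  | scalar r => simp
  | gen x => exact h x
  | mul a b ha hb => rw [map_mul, map_mul, ha, hb]
  | add a b ha hb => rw [map_add, map_add, ha, hb]

theorem xi_comp_smul (E : Jet →ₗ[DPoly] Jet) (c : ℂ) (x : Jet) :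
    xi (E (c • x)) = c • xi (E x) := by
  rw [← map_smul xi, ← LinearMap.map_smul_of_tower]

theorem C_smul_jet (c : ℂ) (x : Jet) : (C c : DPoly) • x = c • x := by
  rw [← MvPolynomial.algebraMap_eq, algebraMap_smul]

theorem HasParity.const_smul {p : Bool} {x : Jet} (hx : HasParity p x) (c : ℂ) :
    HasParity p (c • x) := fun a ha => hx a fun h0 => ha (by simp [h0])

theorem twist_parity (e : Bool) {p : Bool} {x : Jet} (hx : HasParity p x) :
    HasParity p (twist e x) := by
  rw [twist_apply hx]
  exact hx.const_smul _

theorem twist_single (e : Bool) (a : GField) (P : DPoly) :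
    twist e (Finsupp.single a P) = sgn e a.odd • Finsupp.single a P :=
  twist_apply (HasParity.single a P)

/-- The algebra automorphism `a ↦ (-1)^{|e||a|} a`. -/
def parityHom (e : Bool) : Alg →ₐ[ℂ] Alg :=
  liftAlg
    { toFun := fun x => xi (twist e x)
      map_add' := fun x y => by simp
      map_smul' := fun c x => xi_comp_smul _ c x }
    (fun x => by simp [xi_eom])
    (fun μ ν P => by
      simp only [LinearMap.coe_mk, AddHom.coe_mk, twist_single, map_smul, GField.odd]
      rw [xi_symm])
    (fun p q x y hx hy => xi_scomm p q _ _ (twist_parity e hx) (twist_parity e hy))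

theorem parityHom_xi (e : Bool) (x : Jet) : parityHom e (xi x) = xi (twist e x) :=
  liftAlg_xi _ _ _ _ x

theorem twist_false : twist false = LinearMap.id := by
  ext a : 1
  ext
  simp [twist, sgn]

theorem parityHom_false : parityHom false = AlgHom.id ℂ Alg :=
  algHom_ext_xi fun x => by simp [parityHom_xi, twist_false]

section gradedDer

variable (e : Bool) (D : Jet →ₗ[DPoly] Jet)
  (hD : ∀ p x, HasParity p x → HasParity (xor e p) (D x))
  (hs : ∀ μ ν P, xi (D (Finsupp.single (GField.h μ ν) P)) =
    xi (D (Finsupp.single (GField.h ν μ) P)))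

theorem derHom_xi (x : Jet) :
    derHom e D hD hs (xi x) = !![xi (twist e x), xi (D x); 0, xi x] :=
  liftAlg_xi _ _ _ _ x

theorem gradedDer_apply (a : Alg) : gradedDer e D hD hs a = derHom e D hD hs a 0 1 := rfl

theorem gradedDer_xi (x : Jet) : gradedDer e D hD hs (xi x) = xi (D x) := by
  simp [gradedDer_apply, derHom_xi]

/-- The matrices are upper triangular on generators, hence everywhere, and then each diagonal entry
is itself multiplicative. Reading off the upper right entry of a product gives the graded Leibniz
rule. -/
theorem derHom_apply (a : Alg) :
    derHom e D hD hs a = !![parityHom e a, gradedDer e D hD hs a; 0, a] := by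
  suffices h : derHom e D hD hs a 0 0 = parityHom e a ∧ derHom e D hD hs a 1 0 = 0 ∧
      derHom e D hD hs a 1 1 = a by
    ext i j
    fin_cases i <;> fin_cases j <;> simp [h, gradedDer_apply]
  induction a using Alg.induction with
  | scalar r => simp [Matrix.algebraMap_matrix_apply]
  | gen x => simp [derHom_xi, parityHom_xi]
  | mul a b ha hb =>
    simp [Matrix.mul_apply, Fin.sum_univ_two, ha, hb]
  | add a b ha hb => simp [ha, hb]

theorem gradedDer_mul (a b : Alg) : gradedDer e D hD hs (a * b) =
    parityHom e a * gradedDer e D hD hs b + gradedDer e D hD hs a * b := by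
  rw [gradedDer_apply, map_mul, derHom_apply, derHom_apply]
  simp [Matrix.mul_apply, Fin.sum_univ_two]

theorem gradedDer_algebraMap (r : ℂ) : gradedDer e D hD hs (algebraMap ℂ Alg r) = 0 := by
  simp [gradedDer_apply, Matrix.algebraMap_matrix_apply]

end gradedDer

theorem d_xi (μ : Fin 4) (x : Jet) : d μ (xi x) = xi ((X μ : DPoly) • x) :=
  gradedDer_xi _ _ _ _ x

theorem d_mul (μ : Fin 4) (a b : Alg) : d μ (a * b) = a * d μ b + d μ a * b := by
  have := gradedDer_mul false ((X μ : DPoly) • LinearMap.id) (fun p x hx => by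
    simpa using hx.smul (X μ)) (fun ρ σ P => by
      simp only [LinearMap.smul_apply, LinearMap.id_apply]
      rw [Finsupp.smul_single, Finsupp.smul_single]
      exact xi_symm ρ σ _) a b
  rwa [parityHom_false] at this

theorem d_algebraMap (μ : Fin 4) (r : ℂ) : d μ (algebraMap ℂ Alg r) = 0 :=
  gradedDer_algebraMap _ _ _ _ r

/-- The gauge charge on jets. -/
def gaugeJet : Jet →ₗ[DPoly] Jet := Finsupp.linearCombination DPoly gauge

theorem gaugeJet_single (a : GField) (P : DPoly) :
    gaugeJet (Finsupp.single a P) = P • gauge a := by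
  simp [gaugeJet]

theorem dQ_xi (x : Jet) : dQ (xi x) = xi (gaugeJet x) :=
  gradedDer_xi _ _ _ _ x

theorem dQ_mul (a b : Alg) : dQ (a * b) = parityHom true a * dQ b + dQ a * b :=
  gradedDer_mul _ _ _ _ a b

theorem dQ_algebraMap (r : ℂ) : dQ (algebraMap ℂ Alg r) = 0 :=
  gradedDer_algebraMap _ _ _ _ r

theorem d_comm (μ ν : Fin 4) (a : Alg) : d μ (d ν a) = d ν (d μ a) := by
  induction a using Alg.induction with
  | scalar r => simp [d_algebraMap]
  | gen x => simp only [d_xi, smul_smul, mul_comm]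
  | mul a b ha hb => simp only [d_mul, map_add, ha, hb]; abel
  | add a b ha hb => simp only [map_add, ha, hb]

theorem parityHom_d (e : Bool) (μ : Fin 4) (a : Alg) :
    parityHom e (d μ a) = d μ (parityHom e a) := by
  induction a using Alg.induction with
  | scalar r => simp [d_algebraMap]
  | gen x => simp only [d_xi, parityHom_xi, map_smul]
  | mul a b ha hb => simp only [d_mul, map_add, map_mul, ha, hb]
  | add a b ha hb => simp only [map_add, ha, hb]

theorem dQ_d (μ : Fin 4) (a : Alg) : dQ (d μ a) = d μ (dQ a) := by
  induction a using Alg.induction with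
  | scalar r => simp [d_algebraMap, dQ_algebraMap]
  | gen x => simp only [d_xi, dQ_xi, map_smul]
  | mul a b ha hb => simp only [d_mul, dQ_mul, map_add, parityHom_d, ha, hb]; abel
  | add a b ha hb => simp only [map_add, ha, hb]

theorem gaugeJet_twist (x : Jet) : twist true (gaugeJet x) = -gaugeJet (twist true x) := by
  induction x using Finsupp.induction_linear with
  | zero => simp
  | add x y hx hy => simp only [map_add, hx, hy]; abel
  | single a P =>
    rw [twist_single, gaugeJet_single, map_smul, twist_apply (gauge_parity a),
      LinearMap.map_smul_of_tower, gaugeJet_single, smul_comm]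
    cases a <;> simp [GField.odd, sgn]

/-- Since d_Q is odd it anticommutes with the parity involution; this cancels the cross terms in
d_Q²(ab). -/
theorem parityHom_dQ (a : Alg) : parityHom true (dQ a) = -dQ (parityHom true a) := by
  have inv (a : Alg) : parityHom true (parityHom true a) = a := by
    have : (parityHom true).comp (parityHom true) = AlgHom.id ℂ Alg := by
      refine algHom_ext_xi fun x => ?_
      simp only [AlgHom.comp_apply, parityHom_xi, AlgHom.id_apply]
      congr 1
      induction x using Finsupp.induction_linear with
      | zero => simp
      | add x y hx hy => simp only [map_add, hx, hy]
      | single a P =>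
        rw [twist_single, LinearMap.map_smul_of_tower, twist_single, smul_smul]
        cases a <;> simp [GField.odd, sgn]
    exact congrArg (fun f => f a) this
  induction a using Alg.induction with
  | scalar r => simp [dQ_algebraMap]
  | gen x => simp only [dQ_xi, parityHom_xi, gaugeJet_twist, map_neg]
  | mul a b ha hb => simp only [dQ_mul, map_add, map_mul, ha, hb, inv]; noncomm_ring
  | add a b ha hb => simp only [map_add, ha, hb]; abel

/-- The jet `u_τ`. -/
def ghost1 (τ : Fin 4) : Jet := Finsupp.single (GField.u τ) 1

/-- The divergence `d_ρ u^ρ` as a jet. -/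
def divU : Jet := ∑ ρ, ∑ σ, (C (eta ρ σ : ℂ) * X ρ : DPoly) • ghost1 σ

theorem single_u (τ : Fin 4) (P : DPoly) :
    (Finsupp.single (GField.u τ) P : Jet) = P • ghost1 τ := by simp [ghost1]

theorem single_h (σ τ : Fin 4) (P : DPoly) : (Finsupp.single (GField.h σ τ) P : Jet) =
    P • Finsupp.single (GField.h σ τ) 1 := by simp

theorem gauge_h (μ ν : Fin 4) : gauge (GField.h μ ν) = (C (-Complex.I / 2) : DPoly) •
    ((X μ : DPoly) • ghost1 ν + (X ν : DPoly) • ghost1 μ - (C (eta μ ν : ℂ) : DPoly) • divU) := by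
  simp only [gauge, divU, single_u, map_neg, neg_smul, sub_eq_add_neg]

theorem gauge_ut (σ : Fin 4) : gauge (GField.ut σ) = (C Complex.I : DPoly) •
    ∑ lam, ∑ κ, (Finsupp.single (GField.h σ lam) (C (eta lam κ : ℂ) * X κ) : Jet) := rfl

theorem sum_C_mul_C (A B : Matrix (Fin 4) (Fin 4) ℝ) (i k : Fin 4) :
    ∑ j, (C (A i j : ℂ) * C (B j k : ℂ) : DPoly) = C ((A * B) i k : ℂ) := by
  simp only [Matrix.mul_apply, Complex.ofReal_sum, Complex.ofReal_mul, map_sum, map_mul]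

/-- Only ũ needs work: the two gradients of d_ρ u^ρ cancel because of the trace term in d_Q h,
leaving d_Q² ũ_σ = ½ □u_σ, which is zero on shell. -/
theorem gaugeJet_gaugeJet (x : Jet) : xi (gaugeJet (gaugeJet x)) = 0 := by
  have key (a : GField) : ∃ y, gaugeJet (gauge a) = box • y := by
    cases a with
    | h μ ν =>
      refine ⟨0, ?_⟩
      simp only [gauge, map_smul, map_add, map_sum, gaugeJet_single, smul_zero, add_zero,
        Finset.sum_const_zero]
    | u μ => exact ⟨0, by simp [gauge]⟩
    | ut σ =>
      refine ⟨Finsupp.single (GField.u σ) (C (1 / 2)), ?_⟩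
      have hI : (C Complex.I : DPoly) * C (-Complex.I / 2) = C (1 / 2) := by
        rw [← map_mul, ← mul_div_assoc, mul_neg, Complex.I_mul_I, neg_neg]
      simp only [gauge_h, gauge_ut, map_smul, map_sum, gaugeJet_single, smul_sub, smul_add,
        Finset.sum_sub_distrib, Finset.sum_add_distrib]
      have e1 : ∑ lam, ∑ κ, (C (eta lam κ : ℂ) * X κ : DPoly) • (C (-Complex.I / 2) : DPoly) •
          (X σ : DPoly) • ghost1 lam = (C (-Complex.I / 2) * X σ : DPoly) • divU := by
        rw [divU, Finset.sum_comm]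
        simp only [Finset.smul_sum, smul_smul]
        refine Finset.sum_congr rfl fun κ _ => Finset.sum_congr rfl fun lam _ => ?_
        rw [eta_symm]
        congr 1
        ring
      have e2 : ∑ lam, ∑ κ, (C (eta lam κ : ℂ) * X κ : DPoly) • (C (-Complex.I / 2) : DPoly) •
          (X lam : DPoly) • ghost1 σ = (box * C (-Complex.I / 2)) • ghost1 σ := by
        simp only [box, Finset.sum_mul, Finset.sum_smul, smul_smul]
        refine Finset.sum_congr rfl fun κ _ => Finset.sum_congr rfl fun lam _ => ?_
        congr 1
        ring
      have e3 : ∑ lam, ∑ κ, (C (eta lam κ : ℂ) * X κ : DPoly) • (C (-Complex.I / 2) : DPoly) •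
          (C (eta σ lam : ℂ) : DPoly) • divU = (C (-Complex.I / 2) * X σ : DPoly) • divU := by
        simp only [smul_smul, ← Finset.sum_smul]
        congr 1
        rw [Finset.sum_comm]
        calc _ = ∑ κ, (∑ lam, C (eta σ lam : ℂ) * C (eta lam κ : ℂ)) *
                (C (-Complex.I / 2) * X κ : DPoly) := by
              simp only [Finset.sum_mul]
              refine Finset.sum_congr rfl fun κ _ => Finset.sum_congr rfl fun lam _ => ?_
              ring
          _ = _ := by
              simp only [sum_C_mul_C, eta_mul_eta]
              rw [Finset.sum_eq_single σ]
              · simp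
              · intro κ _ hκ
                simp [Matrix.one_apply_ne hκ.symm]
              · simp
      rw [e1, e2, e3, add_sub_cancel_left, smul_smul, mul_comm box, ← mul_assoc, hI, mul_comm,
        mul_smul, ghost1, Finsupp.smul_single, smul_eq_mul, mul_one]
  induction x using Finsupp.induction_linear with
  | zero => simp
  | add x y hx hy => simp only [map_add, hx, hy, add_zero]
  | single a P =>
    obtain ⟨y, hy⟩ := key a
    rw [gaugeJet_single, map_smul, hy, smul_comm, xi_eom]

theorem dQ_dQ (a : Alg) : dQ (dQ a) = 0 := by
  induction a using Alg.induction with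
  | scalar r => simp [dQ_algebraMap]
  | gen x => simp only [dQ_xi, gaugeJet_gaugeJet]
  | mul a b ha hb => simp [dQ_mul, ha, hb, parityHom_dQ]
  | add a b ha hb => simp only [map_add, ha, hb, add_zero]

/-! ### Lorentz transformations of the derivations -/

theorem lorentz_xi {Λ : Matrix (Fin 4) (Fin 4) ℝ} (hΛ : IsLorentz Λ) (x : Jet) :
    lorentz Λ hΛ (xi x) = xi (actJet Λ x) :=
  liftAlg_xi _ _ _ _ x

theorem lorentz_d {Λ : Matrix (Fin 4) (Fin 4) ℝ} (hΛ : IsLorentz Λ) (μ : Fin 4) (a : Alg) :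
    lorentz Λ hΛ (d μ a) = ∑ α, (low Λ μ α : ℂ) • d α (lorentz Λ hΛ a) := by
  induction a using Alg.induction with
  | scalar r => simp [d_algebraMap]
  | gen x =>
    simp only [d_xi, lorentz_xi, actJet_smul, actD, aeval_X, Finset.sum_smul, map_sum]
    refine Finset.sum_congr rfl fun α _ => ?_
    rw [← map_smul xi, mul_smul, C_smul_jet]
  | mul a b ha hb =>
    simp only [d_mul, map_add, map_mul, ha, hb, smul_add, Finset.sum_add_distrib,
      Finset.mul_sum, Finset.sum_mul, mul_smul_comm, smul_mul_assoc]
  | add a b ha hb => simp only [map_add, ha, hb, smul_add, Finset.sum_add_distrib]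

theorem lorentz_parityHom {Λ : Matrix (Fin 4) (Fin 4) ℝ} (hΛ : IsLorentz Λ) (e : Bool) (a : Alg) :
    lorentz Λ hΛ (parityHom e a) = parityHom e (lorentz Λ hΛ a) := by
  have : (lorentz Λ hΛ).comp (parityHom e) = (parityHom e).comp (lorentz Λ hΛ) := by
    refine algHom_ext_xi fun x => ?_
    simp only [AlgHom.comp_apply, parityHom_xi, lorentz_xi]
    congr 1
    induction x using Finsupp.induction_linear with
    | zero => simp
    | add x y hx hy => simp only [map_add, hx, hy]
    | single a P =>
      rw [twist_single, map_smul, twist_apply (actJet_parity Λ (HasParity.single a P))]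
  exact congrArg (fun f => f a) this

/-- `low_isometry` exhibits a left inverse of `low Λ`; for square matrices it is also a right
inverse. -/
theorem low_eta_transpose {Λ : Matrix (Fin 4) (Fin 4) ℝ} (hΛ : IsLorentz Λ) :
    low Λ * eta * (low Λ)ᵀ = eta := by
  have h1 : (eta * (low Λ)ᵀ * eta) * low Λ = 1 := by
    rw [Matrix.mul_assoc, Matrix.mul_assoc, ← Matrix.mul_assoc _ eta, low_isometry hΛ, eta_mul_eta]
  have h2 : low Λ * (eta * (low Λ)ᵀ * eta) = 1 := mul_eq_one_comm.mp h1
  calc low Λ * eta * (low Λ)ᵀ = low Λ * (eta * (low Λ)ᵀ * eta) * eta := by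
        simp only [Matrix.mul_assoc, eta_mul_eta, Matrix.mul_one]
    _ = eta := by rw [h2, Matrix.one_mul]

theorem sum_C_mul_C_mul_C (A B E : Matrix (Fin 4) (Fin 4) ℝ) (i l : Fin 4) :
    ∑ j, ∑ k, (C (A i j : ℂ) * C (B j k : ℂ) * C (E k l : ℂ) : DPoly) =
      C ((A * B * E) i l : ℂ) := by
  rw [← sum_C_mul_C, Finset.sum_comm]
  refine Finset.sum_congr rfl fun κ _ => ?_
  rw [← sum_C_mul_C, Finset.sum_mul]

theorem sum_low_eta_low {Λ : Matrix (Fin 4) (Fin 4) ℝ} (hΛ : IsLorentz Λ) (γ α : Fin 4) :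
    ∑ lam, ∑ κ, (C (low Λ lam γ : ℂ) * C (eta lam κ : ℂ) * C (low Λ κ α : ℂ) : DPoly) =
      C (eta γ α : ℂ) := by
  have h := sum_C_mul_C_mul_C (low Λ)ᵀ eta (low Λ) γ α
  simpa only [low_isometry hΛ, Matrix.transpose_apply] using h

theorem sum_low_eta_low_right {Λ : Matrix (Fin 4) (Fin 4) ℝ} (hΛ : IsLorentz Λ) (μ ν : Fin 4) :
    ∑ α, ∑ β, (C (low Λ μ α : ℂ) * C (eta α β : ℂ) * C (low Λ ν β : ℂ) : DPoly) =
      C (eta μ ν : ℂ) := by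
  have h := sum_C_mul_C_mul_C (low Λ) eta (low Λ)ᵀ μ ν
  simpa only [low_eta_transpose hΛ, Matrix.transpose_apply] using h

theorem actD_C (Λ : Matrix (Fin 4) (Fin 4) ℝ) (c : ℂ) : actD Λ (C c) = C c := by
  simp [actD, MvPolynomial.algebraMap_eq]

theorem actD_X (Λ : Matrix (Fin 4) (Fin 4) ℝ) (μ : Fin 4) :
    actD Λ (X μ) = ∑ α, C (low Λ μ α : ℂ) * X α := by
  simp [actD]

theorem actJet_ghost1 (Λ : Matrix (Fin 4) (Fin 4) ℝ) (τ : Fin 4) :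
    actJet Λ (ghost1 τ) = ∑ α, (C (low Λ τ α : ℂ) : DPoly) • ghost1 α := by
  simp only [ghost1, actJet_single, map_one, one_smul, actField, Finsupp.smul_single, smul_eq_mul,
    mul_one]

section contraction

variable {R M ι : Type*} [CommRing R] [AddCommGroup M] [Module R M] [Fintype ι]

/-- Stated for an arbitrary module so that one computation covers both contractions in the gauge
charge, d_ρ u^ρ and d^λ h_{σλ}. -/
theorem sum_contraction_invariant {e l : ι → ι → R}
    (h : ∀ α β, ∑ ρ, ∑ σ, l ρ α * e ρ σ * l σ β = e α β) (x : ι → R) (u : ι → M) :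
    ∑ ρ, ∑ σ, (e ρ σ * ∑ α, l ρ α * x α) • ∑ β, l σ β • u β =
      ∑ ρ, ∑ σ, (e ρ σ * x ρ) • u σ := by
  simp only [Finset.mul_sum, Finset.sum_smul_sum, smul_smul]
  rw [Finset.sum_congr rfl fun ρ _ => Finset.sum_comm, Finset.sum_comm]
  refine Finset.sum_congr rfl fun α _ => ?_
  rw [Finset.sum_congr rfl fun ρ _ => Finset.sum_comm, Finset.sum_comm]
  refine Finset.sum_congr rfl fun β _ => ?_
  rw [← h α β]
  simp only [Finset.sum_mul, Finset.sum_smul]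
  refine Finset.sum_congr rfl fun ρ _ => Finset.sum_congr rfl fun σ _ => ?_
  congr 1
  ring

theorem sum_bilinear_covariant {e l : ι → ι → R}
    (h : ∀ μ ν, ∑ α, ∑ β, l μ α * e α β * l ν β = e μ ν) (x : ι → R) (u : ι → M) (S : M)
    (μ ν : ι) :
    ∑ α, ∑ β, (l μ α * l ν β) • (x α • u β + x β • u α - e α β • S) =
      (∑ α, l μ α * x α) • ∑ β, l ν β • u β + (∑ α, l ν α * x α) • ∑ β, l μ β • u β -
        e μ ν • S := by
  simp only [smul_sub, smul_add, Finset.sum_sub_distrib, Finset.sum_add_distrib,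
    Finset.sum_smul_sum, smul_smul]
  congr 1
  · congr 1
    · refine Finset.sum_congr rfl fun α _ => Finset.sum_congr rfl fun β _ => ?_
      congr 1
      ring
    · rw [Finset.sum_comm]
      refine Finset.sum_congr rfl fun α _ => Finset.sum_congr rfl fun β _ => ?_
      congr 1
      ring
  · rw [← h μ ν]
    simp only [Finset.sum_smul]
    refine Finset.sum_congr rfl fun α _ => Finset.sum_congr rfl fun β _ => ?_
    congr 1
    ring

end contraction

theorem actJet_divU {Λ : Matrix (Fin 4) (Fin 4) ℝ} (hΛ : IsLorentz Λ) :
    actJet Λ divU = divU := by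
  simp only [divU, map_sum, actJet_smul, map_mul, actD_C, actD_X, actJet_ghost1]
  exact sum_contraction_invariant (e := fun ρ σ => (C (eta ρ σ : ℂ) : DPoly))
    (l := fun ρ σ => (C (low Λ ρ σ : ℂ) : DPoly)) (sum_low_eta_low hΛ) X ghost1

theorem actJet_gauge_ut {Λ : Matrix (Fin 4) (Fin 4) ℝ} (hΛ : IsLorentz Λ) (σ : Fin 4) :
    actJet Λ (gauge (GField.ut σ)) = gaugeJet (actField Λ (GField.ut σ)) := by
  -- The first index of h is already transformed, the second is not: only the latter is contracted
  -- with d, so the invariance of contractions applies to v.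
  let v : Fin 4 → Jet := fun lam =>
    ∑ β, (C (low Λ σ β : ℂ) : DPoly) • Finsupp.single (GField.h β lam) 1
  have h := sum_contraction_invariant (e := fun ρ σ => (C (eta ρ σ : ℂ) : DPoly))
    (l := fun ρ σ => (C (low Λ ρ σ : ℂ) : DPoly)) (sum_low_eta_low hΛ) X v
  have hf (lam : Fin 4) : actField Λ (GField.h σ lam) =
      ∑ γ, (C (low Λ lam γ : ℂ) : DPoly) • v γ := by
    simp only [actField, v, Finset.smul_sum, smul_smul, map_mul]
    rw [Finset.sum_comm]
    refine Finset.sum_congr rfl fun γ _ => Finset.sum_congr rfl fun β _ => ?_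
    rw [single_h, mul_comm]
  have lhs : actJet Λ (gauge (GField.ut σ)) = (C Complex.I : DPoly) •
      ∑ ρ, ∑ τ, (C (eta ρ τ : ℂ) * X ρ : DPoly) • v τ := by
    rw [gauge_ut, actJet_smul, actD_C, ← h, Finset.sum_comm]
    simp only [map_sum, actJet_single, map_mul, actD_C, actD_X, hf]
    refine congrArg (fun y : Jet => (C Complex.I : DPoly) • y) ?_
    refine Finset.sum_congr rfl fun κ _ => Finset.sum_congr rfl fun lam _ => ?_
    rw [eta_symm]
  rw [lhs, Finset.sum_comm]
  have rhs (β : Fin 4) : gaugeJet (Finsupp.single (GField.ut β) (C (low Λ σ β : ℂ))) =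
      (C Complex.I : DPoly) • ∑ lam, ∑ κ, (C (eta κ lam : ℂ) * X κ : DPoly) •
        (C (low Λ σ β : ℂ) : DPoly) • (Finsupp.single (GField.h β lam) 1 : Jet) := by
    rw [gaugeJet_single, gauge_ut, smul_comm, Finset.smul_sum]
    refine congrArg (fun y : Jet => (C Complex.I : DPoly) • y) ?_
    refine Finset.sum_congr rfl fun lam _ => ?_
    rw [Finset.smul_sum]
    refine Finset.sum_congr rfl fun κ _ => ?_
    rw [single_h, smul_comm, eta_symm]
  simp only [actField, map_sum, rhs, v]
  rw [← Finset.smul_sum]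
  refine congrArg (fun y : Jet => (C Complex.I : DPoly) • y) ?_
  symm
  rw [Finset.sum_comm]
  refine Finset.sum_congr rfl fun lam _ => ?_
  rw [Finset.sum_comm]
  refine Finset.sum_congr rfl fun κ _ => ?_
  rw [Finset.smul_sum]

theorem actJet_gauge {Λ : Matrix (Fin 4) (Fin 4) ℝ} (hΛ : IsLorentz Λ) (a : GField) :
    actJet Λ (gauge a) = gaugeJet (actField Λ a) := by
  cases a with
  | h μ ν =>
    have h := sum_bilinear_covariant (e := fun ρ σ => (C (eta ρ σ : ℂ) : DPoly))
      (l := fun ρ σ => (C (low Λ ρ σ : ℂ) : DPoly)) (sum_low_eta_low_right hΛ) X ghost1 divU μ ν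
    rw [gauge_h, actJet_smul, map_sub, map_add, actJet_smul, actJet_smul, actJet_smul,
      actJet_divU hΛ, actD_C, actD_C, actD_X, actD_X, actJet_ghost1, actJet_ghost1, ← h]
    simp only [actField, map_sum, gaugeJet_single, gauge_h, Finset.smul_sum, map_mul]
    refine Finset.sum_congr rfl fun α _ => Finset.sum_congr rfl fun β _ => ?_
    rw [smul_comm]
  | u μ => simp only [gauge, actField, map_zero, map_sum, gaugeJet_single, smul_zero,
      Finset.sum_const_zero]
  | ut σ => exact actJet_gauge_ut hΛ σ

theorem actJet_gaugeJet {Λ : Matrix (Fin 4) (Fin 4) ℝ} (hΛ : IsLorentz Λ) (x : Jet) :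
    actJet Λ (gaugeJet x) = gaugeJet (actJet Λ x) := by
  induction x using Finsupp.induction_linear with
  | zero => simp
  | add x y hx hy => simp only [map_add, hx, hy]
  | single a P => rw [gaugeJet_single, actJet_smul, actJet_single, map_smul, actJet_gauge hΛ]

theorem lorentz_dQ {Λ : Matrix (Fin 4) (Fin 4) ℝ} (hΛ : IsLorentz Λ) (a : Alg) :
    lorentz Λ hΛ (dQ a) = dQ (lorentz Λ hΛ a) := by
  induction a using Alg.induction with
  | scalar r => simp [dQ_algebraMap]
  | gen x => simp only [dQ_xi, lorentz_xi, actJet_gaugeJet hΛ]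
  | mul a b ha hb => simp only [dQ_mul, map_add, map_mul, ha, hb, lorentz_parityHom]
  | add a b ha hb => simp only [map_add, ha, hb]

/-- Lower indices transform contragrediently to upper ones, which makes the divergence of a
covariant vector invariant. -/
theorem low_transpose_mul {Λ : Matrix (Fin 4) (Fin 4) ℝ} (hΛ : IsLorentz Λ) :
    (low Λ)ᵀ * Λ = 1 := by
  have ht : etaᵀ = eta := by simp [eta]
  calc (low Λ)ᵀ * Λ = eta * (Λᵀ * eta * Λ) := by
        simp only [low, Matrix.transpose_mul, ht, Matrix.mul_assoc]
    _ = 1 := by rw [hΛ.1, eta_mul_eta]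

/-! ### Ghost number and canonical dimension of derivatives -/

theorem wickMonomial_mem (L : List JetVar) :
    wickMonomial L ∈ polys {L.length} (ghost L) (omega L) :=
  Submodule.subset_span ⟨L, rfl, rfl, le_rfl, rfl⟩

theorem polys_mono {D D' : Set ℕ} (hD : D ⊆ D') {g w w' : ℤ} (hw : w ≤ w') :
    polys D g w ≤ polys D' g w' := by
  refine Submodule.span_mono ?_
  rintro _ ⟨L, h1, h2, h3, rfl⟩
  exact ⟨L, hD h1, h2, h3.trans hw, rfl⟩

theorem polys_mul_mem {m n : ℕ} {g g' w w' : ℤ} {A B : Alg} (hA : A ∈ polys {m} g w)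
    (hB : B ∈ polys {n} g' w') : A * B ∈ polys {m + n} (g + g') (w + w') := by
  have h := Submodule.mul_mem_mul hA hB
  rw [polys, polys, Submodule.span_mul_span] at h
  refine Submodule.span_mono ?_ h
  rintro _ ⟨_, ⟨L, h1, h2, h3, rfl⟩, _, ⟨L', h1', h2', h3', rfl⟩, rfl⟩
  refine ⟨L ++ L', ?_, ?_, ?_, ?_⟩
  · simp only [Set.mem_singleton_iff] at h1 h1' ⊢
    rw [List.length_append, h1, h1']
  · rw [← h2, ← h2', ghost, List.map_append, List.sum_append]; rfl
  · rw [omega, List.map_append, List.sum_append]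
    exact add_le_add h3 h3'
  · simp [wickMonomial]

theorem xi_monomial_mem (a : GField) (k : Fin 4 →₀ ℕ) (c : ℂ) {g w : ℤ} (hg : a.gh = g)
    (hw : 1 + (k.degree : ℤ) ≤ w) :
    xi (Finsupp.single a (MvPolynomial.monomial k c)) ∈ polys {1} g w := by
  have h : (Finsupp.single a (MvPolynomial.monomial k c) : Jet) =
      c • Finsupp.single a (MvPolynomial.monomial k 1) := by
    rw [Finsupp.smul_single, MvPolynomial.smul_monomial, smul_eq_mul, mul_one]
  rw [h, map_smul]
  refine Submodule.smul_mem _ _ (Submodule.subset_span ⟨[(a, k)], rfl, ?_, ?_, ?_⟩)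
  · simpa [ghost] using hg
  · simpa [omega] using hw
  · simp [wickMonomial]

theorem monomial_mul_C_mul_X (k : Fin 4 →₀ ℕ) (c : ℂ) (κ : Fin 4) :
    (MvPolynomial.monomial k 1 * (C c * X κ) : DPoly) =
      MvPolynomial.monomial (k + Finsupp.single κ 1) c := by
  rw [C_mul_X_eq_monomial, MvPolynomial.monomial_mul, one_mul]

/-- Every term of d_Q ξ is again linear in the fields, carries one more derivative and has ghost
number one higher. -/
theorem xi_gauge_mem (a : GField) (k : Fin 4 →₀ ℕ) :
    xi ((MvPolynomial.monomial k 1 : DPoly) • gauge a) ∈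
      polys {1} (a.gh + 1) (1 + k.degree + 1) := by
  have key (b : GField) (κ : Fin 4) (c : ℂ) (hb : b.gh = a.gh + 1) :
      xi ((MvPolynomial.monomial k 1 : DPoly) • Finsupp.single b (C c * X κ)) ∈
        polys {1} (a.gh + 1) (1 + k.degree + 1) := by
    rw [Finsupp.smul_single, smul_eq_mul, monomial_mul_C_mul_X]
    exact xi_monomial_mem _ _ _ hb (by simp [add_assoc])
  have key' (b : GField) (κ : Fin 4) (hb : b.gh = a.gh + 1) :
      xi ((MvPolynomial.monomial k 1 : DPoly) • Finsupp.single b (X κ)) ∈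
        polys {1} (a.gh + 1) (1 + k.degree + 1) := by
    simpa using key b κ 1 hb
  have hC (c : ℂ) (x : Jet) (hx : xi ((MvPolynomial.monomial k 1 : DPoly) • x) ∈
      polys {1} (a.gh + 1) (1 + k.degree + 1)) :
      xi ((MvPolynomial.monomial k 1 : DPoly) • (C c : DPoly) • x) ∈
        polys {1} (a.gh + 1) (1 + k.degree + 1) := by
    rw [smul_comm, C_smul_jet, map_smul]
    exact Submodule.smul_mem _ _ hx
  cases a with
  | h μ ν =>
    refine hC _ _ ?_
    rw [smul_add, smul_add, map_add, map_add]
    refine Submodule.add_mem _ (Submodule.add_mem _ (key' (GField.u ν) μ rfl)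
      (key' (GField.u μ) ν rfl)) (hC _ _ ?_)
    simp only [Finset.smul_sum, map_sum]
    exact Submodule.sum_mem _ fun ρ _ => Submodule.sum_mem _ fun σ _ =>
      key (GField.u σ) ρ _ rfl
  | u μ => simp [gauge]
  | ut σ =>
    refine hC _ _ ?_
    simp only [Finset.smul_sum, map_sum]
    exact Submodule.sum_mem _ fun lam _ => Submodule.sum_mem _ fun κ _ =>
      key (GField.h σ lam) κ _ rfl

theorem wickMonomial_cons (v : JetVar) (L : List JetVar) : wickMonomial (v :: L) =
    xi (Finsupp.single v.1 (MvPolynomial.monomial v.2 1)) * wickMonomial L := by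
  simp [wickMonomial]

theorem wickMonomial_nil : wickMonomial [] = algebraMap ℂ Alg 1 := by
  simp [wickMonomial]

theorem polys_length_cons {v : JetVar} {L : List JetVar} {g w g' w' : ℤ} {A : Alg}
    (h : A ∈ polys {1 + L.length} g w) (hg : g = g') (hw : w = w') :
    A ∈ polys {(v :: L).length} g' w' := by
  rw [List.length_cons, add_comm, ← hg, ← hw]
  exact h

theorem d_wickMonomial_mem (μ : Fin 4) (L : List JetVar) :
    d μ (wickMonomial L) ∈ polys {L.length} (ghost L) (omega L + 1) := by
  induction L with
  | nil => rw [wickMonomial_nil, d_algebraMap]; exact Submodule.zero_mem _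
  | cons v L ih =>
    rw [wickMonomial_cons, d_mul, d_xi, Finsupp.smul_single, smul_eq_mul, mul_comm (X μ)]
    have h1 := monomial_mul_C_mul_X v.2 1 μ
    rw [C_1, one_mul] at h1
    rw [h1]
    refine Submodule.add_mem _ ?_ ?_
    · refine polys_length_cons
        (polys_mul_mem (xi_monomial_mem v.1 v.2 1 rfl le_rfl) ih) ?_ ?_
      · simp [ghost]
      · simp [omega, add_assoc]
    · refine polys_length_cons
        (polys_mul_mem (xi_monomial_mem v.1 _ 1 rfl le_rfl) (wickMonomial_mem L)) ?_ ?_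
      · simp [ghost]
      · simp [omega]; ring

theorem dQ_wickMonomial_mem (L : List JetVar) :
    dQ (wickMonomial L) ∈ polys {L.length} (ghost L + 1) (omega L + 1) := by
  induction L with
  | nil => rw [wickMonomial_nil, dQ_algebraMap]; exact Submodule.zero_mem _
  | cons v L ih =>
    rw [wickMonomial_cons, dQ_mul, dQ_xi, parityHom_xi, twist_single, map_smul, gaugeJet_single,
      smul_mul_assoc]
    refine Submodule.add_mem _ (Submodule.smul_mem _ _ ?_) ?_
    · refine polys_length_cons
        (polys_mul_mem (xi_monomial_mem v.1 v.2 1 rfl le_rfl) ih) ?_ ?_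
      · simp [ghost, add_assoc]
      · simp [omega, add_assoc]
    · refine polys_length_cons
        (polys_mul_mem (xi_gauge_mem v.1 v.2) (wickMonomial_mem L)) ?_ ?_
      · simp [ghost]; ring
      · simp [omega]; ring

theorem map_mem_polys {f : Alg →ₗ[ℂ] Alg} {r : ℤ}
    (hf : ∀ L, f (wickMonomial L) ∈ polys {L.length} (ghost L + r) (omega L + 1)) {D : Set ℕ}
    {g w : ℤ} {A : Alg} (hA : A ∈ polys D g w) : f A ∈ polys D (g + r) (w + 1) := by
  suffices h : polys D g w ≤ (polys D (g + r) (w + 1)).comap f from h hA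
  refine Submodule.span_le.mpr ?_
  rintro _ ⟨L, h1, rfl, h3, rfl⟩
  exact polys_mono (by simpa using h1) (by linarith) (hf L)

theorem d_mem_polys (μ : Fin 4) {D : Set ℕ} {g w g' w' : ℤ} {A : Alg} (hA : A ∈ polys D g w)
    (hg : g = g') (hw : w + 1 ≤ w') : d μ A ∈ polys D g' w' := by
  have h := map_mem_polys (f := d μ) (r := 0) (by simpa using d_wickMonomial_mem μ) hA
  rw [add_zero, hg] at h
  exact polys_mono subset_rfl hw h

theorem dQ_mem_polys {D : Set ℕ} {g w g' w' : ℤ} {A : Alg} (hA : A ∈ polys D g w)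
    (hg : g + 1 = g') (hw : w + 1 ≤ w') : dQ A ∈ polys D g' w' := by
  have h := map_mem_polys (f := dQ) dQ_wickMonomial_mem hA
  rw [hg] at h
  exact polys_mono subset_rfl hw h

/-! ### Operators on quasi-local expressions -/

theorem del1_single (μ : Fin 4) (k : Fin 4 →₀ ℕ) (W : Alg) :
    del1 μ (Finsupp.single k W) = Finsupp.single (k + Finsupp.single μ 1) W := by
  simp [del1]

theorem onCoeff_single (f : Alg →ₗ[ℂ] Alg) (k : Fin 4 →₀ ℕ) (W : Alg) :
    onCoeff f (Finsupp.single k W) = Finsupp.single k (f W) := by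
  simp [onCoeff]

theorem onCoeff_delta (f : Alg →ₗ[ℂ] Alg) (W : Alg) : onCoeff f (delta W) = delta (f W) :=
  onCoeff_single f 0 W

theorem onCoeff_del1 (f : Alg →ₗ[ℂ] Alg) (μ : Fin 4) (x : QuasiLocal) :
    onCoeff f (del1 μ x) = del1 μ (onCoeff f x) := by
  induction x using Finsupp.induction_linear with
  | zero => simp
  | add x y hx hy => simp only [map_add, hx, hy]
  | single k W => simp only [del1_single, onCoeff_single]

theorem onCoeff_onCoeff (f g : Alg →ₗ[ℂ] Alg) (x : QuasiLocal) :
    onCoeff f (onCoeff g x) = onCoeff (f ∘ₗ g) x := by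
  induction x using Finsupp.induction_linear with
  | zero => simp
  | add x y hx hy => simp only [map_add, hx, hy]
  | single k W => simp only [onCoeff_single, LinearMap.comp_apply]

theorem del1_comm (μ ν : Fin 4) (x : QuasiLocal) : del1 μ (del1 ν x) = del1 ν (del1 μ x) := by
  induction x using Finsupp.induction_linear with
  | zero => simp
  | add x y hx hy => simp only [map_add, hx, hy]
  | single k W => simp only [del1_single, add_right_comm]

theorem del2_apply (μ : Fin 4) (x : QuasiLocal) : del2 μ x = onCoeff (d μ) x - del1 μ x := rfl

theorem onCoeff_d_comm (μ ν : Fin 4) (x : QuasiLocal) :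
    onCoeff (d μ) (onCoeff (d ν) x) = onCoeff (d ν) (onCoeff (d μ) x) := by
  rw [onCoeff_onCoeff, onCoeff_onCoeff]
  congr 2
  ext a
  exact d_comm μ ν a

theorem onCoeff_dQ_d (μ : Fin 4) (x : QuasiLocal) :
    onCoeff dQ (onCoeff (d μ) x) = onCoeff (d μ) (onCoeff dQ x) := by
  rw [onCoeff_onCoeff, onCoeff_onCoeff]
  congr 2
  ext a
  exact dQ_d μ a

theorem onCoeff_dQ_dQ (x : QuasiLocal) : onCoeff dQ (onCoeff dQ x) = 0 := by
  have h : dQ ∘ₗ dQ = 0 := by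
    ext a
    exact dQ_dQ a
  rw [onCoeff_onCoeff, h]
  ext k
  simp [onCoeff]

theorem onCoeff_dQ_del2 (μ : Fin 4) (x : QuasiLocal) :
    onCoeff dQ (del2 μ x) = del2 μ (onCoeff dQ x) := by
  simp only [del2_apply, map_sub, onCoeff_dQ_d, onCoeff_del1]

theorem del1_del2 (μ ν : Fin 4) (x : QuasiLocal) : del1 μ (del2 ν x) = del2 ν (del1 μ x) := by
  simp only [del2_apply, map_sub, onCoeff_del1, del1_comm μ ν]

theorem del2_comm (μ ν : Fin 4) (x : QuasiLocal) : del2 μ (del2 ν x) = del2 ν (del2 μ x) := by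
  simp only [del2_apply, map_sub, onCoeff_del1, del1_comm μ ν, onCoeff_d_comm μ ν]
  abel

/-! #### The exchange of the two arguments -/

/-- Every quasi-local expression arises from terms δW by applying ∂^1 and adding, so operators with
known commutation relations with ∂^1 need only be compared on δW. -/
theorem QuasiLocal.induction_del1 {p : QuasiLocal → Prop} (zero : p 0)
    (add : ∀ x y, p x → p y → p (x + y)) (hdelta : ∀ W, p (delta W))
    (hdel : ∀ μ x, p x → p (del1 μ x)) (x : QuasiLocal) : p x := by
  induction x using Finsupp.induction_linear with
  | zero => exact zero
  | add x y hx hy => exact add x y hx hy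
  | single k W =>
    suffices h : ∀ l : Fin 4 →₀ ℕ, p (Finsupp.single l W) → p (Finsupp.single (l + k) W) by
      simpa using h 0 (hdelta W)
    induction k using Finsupp.induction_linear with
    | zero => simp
    | add k l hk hl => exact fun m hm => add_assoc m k l ▸ hl _ (hk _ hm)
    | single μ n =>
      intro l hl
      induction n with
      | zero => simpa using hl
      | succ n ih =>
        rw [Finsupp.single_add, ← add_assoc, ← del1_single]
        exact hdel _ _ ih

theorem exchange_single (k : Fin 4 →₀ ℕ) (W : Alg) : exchange (Finsupp.single k W) =
    ((List.finRange 4).map fun μ => del2 μ ^ k μ).prod (delta W) := by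
  simp [exchange]

theorem exchange_delta (W : Alg) : exchange (delta W) = delta W := by
  rw [delta, Finsupp.lsingle_apply, exchange_single]
  simp [delta]

/-- The operators ∂^2_μ commute, so the extra factor can be moved to its place in the ordered
product that defines `exchange`. -/
theorem exchange_del1 (μ : Fin 4) (x : QuasiLocal) :
    exchange (del1 μ x) = del2 μ (exchange x) := by
  have hc (ρ σ : Fin 4) : Commute (del2 ρ) (del2 σ) := LinearMap.ext (del2_comm ρ σ)
  induction x using Finsupp.induction_linear with
  | zero => simp
  | add x y hx hy => simp only [map_add, hx, hy]
  | single k W =>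
    rw [del1_single, exchange_single, exchange_single, ← Module.End.mul_apply]
    congr 1
    have hl (ρ σ : Fin 4) (n : ℕ) := ((hc ρ σ).pow_right n).left_comm
    simp only [List.finRange_succ, List.finRange_zero, List.map_cons, List.map_nil, List.prod_cons,
      List.prod_nil, mul_one, Finsupp.add_apply]
    fin_cases μ
    · simp [pow_succ', mul_assoc]
    · simp [pow_succ', mul_assoc, hl 1 0]
    · simp [pow_succ', mul_assoc, hl 2 0, hl 2 1]
    · simp [pow_succ', hl 3 0, hl 3 1, hl 3 2]

theorem exchange_onCoeff_d (μ : Fin 4) (x : QuasiLocal) :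
    exchange (onCoeff (d μ) x) = onCoeff (d μ) (exchange x) := by
  induction x using QuasiLocal.induction_del1 with
  | zero => simp
  | add x y hx hy => simp only [map_add, hx, hy]
  | hdelta W => simp only [onCoeff_delta, exchange_delta]
  | hdel ν x ih =>
    simp only [onCoeff_del1, exchange_del1, ih, del2_apply, map_sub, onCoeff_d_comm μ ν]

theorem exchange_onCoeff_dQ (x : QuasiLocal) :
    exchange (onCoeff dQ x) = onCoeff dQ (exchange x) := by
  induction x using QuasiLocal.induction_del1 with
  | zero => simp
  | add x y hx hy => simp only [map_add, hx, hy]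
  | hdelta W => simp only [onCoeff_delta, exchange_delta]
  | hdel ν x ih => simp only [onCoeff_del1, exchange_del1, ih, onCoeff_dQ_del2]

theorem exchange_del2 (μ : Fin 4) (x : QuasiLocal) :
    exchange (del2 μ x) = del1 μ (exchange x) := by
  rw [del2_apply, map_sub, exchange_onCoeff_d, exchange_del1, del2_apply, sub_sub_cancel]

theorem exchange_exchange (x : QuasiLocal) : exchange (exchange x) = x := by
  induction x using QuasiLocal.induction_del1 with
  | zero => simp
  | add x y hx hy => simp only [map_add, hx, hy]
  | hdelta W => simp only [exchange_delta]
  | hdel ν x ih => rw [exchange_del1, exchange_del2, ih]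

/-! #### Extraction of coefficients -/

/-- The formal derivative with respect to `∂_α` of polynomials in `∂` applied to the delta
function. -/
def lower (α : Fin 4) : QuasiLocal →ₗ[ℂ] QuasiLocal :=
  Finsupp.lsum ℂ fun k => (k α : ℂ) • Finsupp.lsingle (k - Finsupp.single α 1)

theorem lower_single (α : Fin 4) (k : Fin 4 →₀ ℕ) (W : Alg) :
    lower α (Finsupp.single k W) = (k α : ℂ) • Finsupp.single (k - Finsupp.single α 1) W := by
  simp [lower]

theorem lower_delta (α : Fin 4) (W : Alg) : lower α (delta W) = 0 := by
  rw [delta, Finsupp.lsingle_apply, lower_single]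
  simp

/-- The Heisenberg relation [∂/∂(∂_α), ∂_μ] = δ_{αμ}. Applying `lower` repeatedly and then
`deltaCoeff` thus reads off Taylor coefficients without any work with multi-indices. -/
theorem lower_del1 (α μ : Fin 4) (x : QuasiLocal) :
    lower α (del1 μ x) = (if α = μ then x else 0) + del1 μ (lower α x) := by
  induction x using Finsupp.induction_linear with
  | zero => simp
  | add x y hx hy =>
    simp only [map_add, hx, hy]
    split_ifs <;> abel
  | single k W =>
    rw [del1_single, lower_single, lower_single, map_smul, del1_single]
    have hk (h : k α ≠ 0) : Finsupp.single α 1 ≤ k := by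
      rw [Finsupp.single_le_iff]
      omega
    by_cases h0 : k α = 0
    · by_cases h : α = μ
      · subst h
        simp [h0]
      · simp [h0, h]
    · rw [← tsub_add_eq_add_tsub (hk h0)]
      by_cases h : α = μ
      · subst h
        rw [tsub_add_cancel_of_le (hk h0)]
        simp [add_smul, add_comm]
      · simp [h]

theorem lower_onCoeff (α : Fin 4) (f : Alg →ₗ[ℂ] Alg) (x : QuasiLocal) :
    lower α (onCoeff f x) = onCoeff f (lower α x) := by
  induction x using Finsupp.induction_linear with
  | zero => simp
  | add x y hx hy => simp only [map_add, hx, hy]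
  | single k W => simp only [onCoeff_single, lower_single, map_smul]

/-- The coefficient of `δ`. -/
def deltaCoeff : QuasiLocal →ₗ[ℂ] Alg := Finsupp.lapply 0

theorem deltaCoeff_delta (W : Alg) : deltaCoeff (delta W) = W := by
  simp [deltaCoeff, delta]

theorem deltaCoeff_del1 (μ : Fin 4) (x : QuasiLocal) : deltaCoeff (del1 μ x) = 0 := by
  induction x using Finsupp.induction_linear with
  | zero => simp
  | add x y hx hy => simp only [map_add, hx, hy, add_zero]
  | single k W =>
    rw [del1_single, deltaCoeff, Finsupp.lapply_apply, Finsupp.single_apply, if_neg]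
    intro h
    simpa using DFunLike.congr_fun h μ

/-! ### The Koszul homotopy -/

section koszul

variable {V : Type*} [AddCommGroup V]

/-- Exterior multiplication: `∑_k (-1)^k F(i_k)(I \ i_k)` for the multi-index `I = i_0 i_1 …`. -/
def wedge : Idx → (Fin 4 → Idx → V) → V
  | [], _ => 0
  | i :: I, F => F i I - wedge I fun μ K => F μ (i :: K)

/-- `wedge I` evaluates its argument only at multi-indices one shorter than I, so signs depending on
|K| may be rewritten in terms of |I|. -/
theorem wedge_congr {I : Idx} {F G : Fin 4 → Idx → V}
    (h : ∀ μ K, K.length + 1 = I.length → F μ K = G μ K) : wedge I F = wedge I G := by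
  induction I generalizing F G with
  | nil => rfl
  | cons i I ih =>
    rw [wedge, wedge, h i I rfl, ih fun μ K hK => h μ (i :: K) (by simp [hK])]

theorem wedge_add (I : Idx) (F G : Fin 4 → Idx → V) :
    wedge I (fun μ K => F μ K + G μ K) = wedge I F + wedge I G := by
  induction I generalizing F G with
  | nil => simp [wedge]
  | cons i I ih =>
    simp only [wedge, ih]
    abel

theorem IsSkew.shift {f : Idx → V} (hf : IsSkew f) (i : Fin 4) : IsSkew fun K => f (i :: K) :=
  fun I I' μ ν => hf (i :: I) I' μ ν

theorem IsSkew.add {f g : Idx → V} (hf : IsSkew f) (hg : IsSkew g) :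
    IsSkew fun I => f I + g I := fun I I' μ ν => by
  beta_reduce
  rw [hf I I' μ ν, hg I I' μ ν, neg_add]

variable [Module ℂ V]

theorem map_wedge {W : Type*} [AddCommGroup W] [Module ℂ W] (φ : V →ₗ[ℂ] W) (I : Idx)
    (F : Fin 4 → Idx → V) : φ (wedge I F) = wedge I fun μ K => φ (F μ K) := by
  induction I generalizing F with
  | nil => simp [wedge]
  | cons i I ih => simp only [wedge, map_sub, ih]

theorem wedge_smul (c : ℂ) (I : Idx) (F : Fin 4 → Idx → V) :
    wedge I (fun μ K => c • F μ K) = c • wedge I F :=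
  (map_wedge (LinearMap.lsmul ℂ V c) I F).symm

theorem wedge_zero (I : Idx) : wedge I (fun _ _ => (0 : V)) = 0 := by
  simpa using wedge_smul (0 : ℂ) I fun _ _ => (0 : V)

theorem wedge_neg (I : Idx) (F : Fin 4 → Idx → V) :
    wedge I (fun μ K => -F μ K) = -wedge I F := by
  simpa using wedge_smul (-1 : ℂ) I F

theorem wedge_sub (I : Idx) (F G : Fin 4 → Idx → V) :
    wedge I (fun μ K => F μ K - G μ K) = wedge I F - wedge I G := by
  simp only [sub_eq_add_neg, wedge_add, wedge_neg]

theorem wedge_sum {ι : Type*} (s : Finset ι) (I : Idx) (F : ι → Fin 4 → Idx → V) :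
    wedge I (fun μ K => ∑ i ∈ s, F i μ K) = ∑ i ∈ s, wedge I (F i) := by
  classical
  induction s using Finset.induction_on with
  | empty => simp [wedge_zero]
  | insert a s ha ih => simp only [Finset.sum_insert ha, wedge_add, ih]

theorem wedge_mem {S : Submodule ℂ V} {I : Idx} {F : Fin 4 → Idx → V}
    (h : ∀ μ K, K.length + 1 = I.length → F μ K ∈ S) : wedge I F ∈ S := by
  induction I generalizing F with
  | nil => exact S.zero_mem
  | cons i I ih =>
    exact S.sub_mem (h i I rfl) (ih fun μ K hK => h μ (i :: K) (by simp [hK]))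

theorem wedge_skew {F : Fin 4 → Idx → V} (hF : ∀ μ, IsSkew (F μ)) :
    IsSkew fun I => wedge I F := by
  intro I I' μ ν
  induction I generalizing F with
  | nil =>
    have h : wedge I' (fun ρ K => F ρ (μ :: ν :: K)) =
        -wedge I' fun ρ K => F ρ (ν :: μ :: K) := by
      rw [← wedge_neg]
      exact wedge_congr fun ρ K _ => hF ρ [] K μ ν
    simp only [List.nil_append, wedge, h]
    abel
  | cons i I ih =>
    have h1 := hF i I I' μ ν
    have h2 := ih (F := fun ρ K => F ρ (i :: K)) fun ρ => (hF ρ).shift i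
    simp only [List.cons_append, wedge] at h1 h2 ⊢
    rw [h1, h2]
    abel

/-- Euler's identity for forms: each of the |I| terms equals f(I) once the extracted index is moved
back to its place by skewness. -/
theorem wedge_cons_eq_length_smul {f : Idx → V} (hf : IsSkew f) (I : Idx) :
    wedge I (fun μ K => f (μ :: K)) = (I.length : ℂ) • f I := by
  induction I generalizing f with
  | nil => simp [wedge]
  | cons i I ih =>
    have h : wedge I (fun μ K => f (μ :: i :: K)) = -wedge I fun μ K => f (i :: μ :: K) := by
      rw [← wedge_neg]
      exact wedge_congr fun ρ K _ => hf [] K ρ i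
    rw [wedge, h, ih (f := fun K => f (i :: K)) (hf.shift i), List.length_cons]
    push_cast
    rw [add_smul, one_smul]
    abel

/-! ### Contraction and number operator -/

/-- The difference of the two interior multiplications. -/
def contr (μ : Fin 4) (f : Idx → Idx → V) : Idx → Idx → V :=
  fun I J => f (μ :: I) J - (-1 : ℂ) ^ I.length • f I (μ :: J)

/-- The operator that moves an index from the second multi-index to the first. -/
def transfer (f : Idx → Idx → V) : Idx → Idx → V :=
  fun I J => wedge I fun ρ K => (-1 : ℂ) ^ K.length • f K (ρ :: J)

/-- The number operator of the Koszul complex. -/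
def koszulNumber (f : Idx → Idx → V) : Idx → Idx → V :=
  fun I J => wedge I fun ρ K => contr ρ f K J

/-- The anticommutation relation of interior and exterior multiplication. The contraction with J
also anticommutes with `wedge`, because removing an index from I flips the sign (-1)^{|I|}; so only
the contraction with I produces the extra term. -/
theorem contr_wedge (μ : Fin 4) (F : Fin 4 → Idx → Idx → V) (I J : Idx) :
    contr μ (fun I J => wedge I fun ρ K => F ρ K J) I J =
      F μ I J - wedge I fun ρ K => contr μ (F ρ) K J := by
  have h : wedge I (fun ρ K => (-1 : ℂ) ^ K.length • F ρ K (μ :: J)) =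
      -((-1 : ℂ) ^ I.length • wedge I fun ρ K => F ρ K (μ :: J)) := by
    rw [← wedge_smul, ← wedge_neg]
    refine wedge_congr fun ρ K hK => ?_
    rw [← hK, pow_succ]
    simp
  simp only [contr, wedge, wedge_sub, h]
  abel

/-- In this form the number operator is triangular with respect to |I|: `transfer` evaluates f only
at first multi-indices shorter by one. -/
theorem koszulNumber_eq {f : Idx → Idx → V} (hf : ∀ J, IsSkew fun I => f I J) (I J : Idx) :
    koszulNumber f I J = (I.length : ℂ) • f I J - transfer f I J := by
  rw [← wedge_cons_eq_length_smul (hf J), transfer, ← wedge_sub]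
  rfl

theorem contr_contr {f : Idx → Idx → V} (hf : ∀ J, IsSkew fun I => f I J)
    (hf' : ∀ I, IsSkew fun J => f I J) (μ ρ : Fin 4) (I J : Idx) :
    contr μ (contr ρ f) I J = -contr ρ (contr μ f) I J := by
  have h1 := hf J [] I μ ρ
  have h2 := hf' I [] J μ ρ
  simp only [List.nil_append] at h1 h2
  simp only [contr, List.length_cons, pow_succ, h1, h2, smul_sub, smul_smul, mul_neg, mul_one,
    neg_smul, smul_neg]
  abel

/-- A contraction lowers the number by one. This follows from `contr_wedge` and the anticommutation
of contractions. -/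
theorem contr_koszulNumber {f : Idx → Idx → V} (hf : ∀ J, IsSkew fun I => f I J)
    (hf' : ∀ I, IsSkew fun J => f I J) (μ : Fin 4) (I J : Idx) :
    contr μ (koszulNumber f) I J = contr μ f I J + koszulNumber (contr μ f) I J := by
  have h := contr_wedge μ (fun ρ => contr ρ f) I J
  rw [show contr μ (koszulNumber f) I J = _ from h, koszulNumber, sub_eq_add_neg, ← wedge_neg]
  congr 1
  refine wedge_congr fun ρ K _ => ?_
  rw [contr_contr hf hf' ρ μ]

theorem contr_skew_left {f : Idx → Idx → V} (hf : ∀ J, IsSkew fun I => f I J) (μ : Fin 4)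
    (J : Idx) : IsSkew fun I => contr μ f I J := by
  intro I I' ρ σ
  have h1 := hf J (μ :: I) I' ρ σ
  have h2 := hf (μ :: J) I I' ρ σ
  simp only [List.cons_append] at h1 h2
  simp only [contr, h1, h2, List.length_append, List.length_cons, smul_neg]
  abel

theorem transfer_congr {f g : Idx → Idx → V} {I : Idx} (J : Idx)
    (h : ∀ K J, K.length + 1 = I.length → f K J = g K J) : transfer f I J = transfer g I J :=
  wedge_congr fun ρ K hK => by rw [h K _ hK]

/-- Injectivity of m + 1 + n: the operator is triangular in |I|, and its diagonal entries m + 1 +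
|I| do not vanish. -/
theorem eq_zero_of_koszulNumber {f : Idx → Idx → V} (hf : ∀ J, IsSkew fun I => f I J) (m : ℕ)
    (h : ∀ I J, ((m : ℂ) + 1) • f I J + koszulNumber f I J = 0) (I J : Idx) : f I J = 0 := by
  induction hn : I.length generalizing I J with
  | zero =>
    have h1 := h I J
    rw [List.length_eq_zero_iff] at hn
    subst hn
    simp only [koszulNumber, wedge, add_zero] at h1
    exact (smul_eq_zero.mp h1).resolve_left (Nat.cast_add_one_ne_zero m)
  | succ n ih =>
    have h1 := h I J
    have h2 : transfer f I J = 0 := by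
      rw [transfer_congr (g := fun _ _ => 0) J fun K J hK => ih K J (by omega), transfer]
      simp [wedge_zero]
    rw [koszulNumber_eq hf, h2, sub_zero, ← add_smul] at h1
    refine (smul_eq_zero.mp h1).resolve_left ?_
    norm_cast
    omega

/-! ### Inversion of `2 + n` and exactness -/

/-- The solutions of `(2 + n) g = f` up to a given length of the first multi-index. -/
def koszulStage (f : Idx → Idx → V) : ℕ → Idx → Idx → V
  | 0 => fun I J => (2 : ℂ)⁻¹ • f I J
  -- At length |I| = k + 1 the diagonal entry of 2 + n is k + 3.
  | k + 1 => fun I J => ((k : ℂ) + 3)⁻¹ • (f I J + transfer (koszulStage f k) I J)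

/-- The solution of `(2 + n) g = f`. -/
def koszulInv (f : Idx → Idx → V) : Idx → Idx → V := fun I J => koszulStage f I.length I J

theorem transfer_skew_left {f : Idx → Idx → V} (hf : ∀ J, IsSkew fun I => f I J) (J : Idx) :
    IsSkew fun I => transfer f I J := by
  refine wedge_skew fun ρ I I' μ ν => ?_
  have h := hf (ρ :: J) I I' μ ν
  simp only at h
  simp [h]

theorem transfer_skew_right {f : Idx → Idx → V} (hf : ∀ I, IsSkew fun J => f I J) (I : Idx) :
    IsSkew fun J => transfer f I J := by
  intro J J' μ ν
  simp only [transfer]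
  rw [← wedge_neg]
  refine wedge_congr fun ρ K _ => ?_
  have h := hf K (ρ :: J) J' μ ν
  simp only [List.cons_append] at h
  rw [h, smul_neg]

theorem IsSkew.smul {f : Idx → V} (hf : IsSkew f) (c : ℂ) : IsSkew fun I => c • f I :=
  fun I I' μ ν => by beta_reduce; rw [hf I I' μ ν, smul_neg]

theorem koszulStage_skew_left {f : Idx → Idx → V} (hf : ∀ J, IsSkew fun I => f I J) (k : ℕ)
    (J : Idx) : IsSkew fun I => koszulStage f k I J := by
  induction k generalizing J with
  | zero => exact (hf J).smul _
  | succ k ih => exact ((hf J).add (transfer_skew_left ih J)).smul _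

theorem koszulStage_skew_right {f : Idx → Idx → V} (hf : ∀ I, IsSkew fun J => f I J) (k : ℕ)
    (I : Idx) : IsSkew fun J => koszulStage f k I J := by
  induction k generalizing I with
  | zero => exact (hf I).smul _
  | succ k ih => exact ((hf I).add (transfer_skew_right ih I)).smul _

/-- The stage used depends on I only through its length, which a transposition preserves. -/
theorem koszulInv_skew_left {f : Idx → Idx → V} (hf : ∀ J, IsSkew fun I => f I J) (J : Idx) :
    IsSkew fun I => koszulInv f I J := fun I I' μ ν => by
  have h := koszulStage_skew_left hf (I ++ μ :: ν :: I').length J I I' μ ν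
  have hl : (I ++ μ :: ν :: I').length = (I ++ ν :: μ :: I').length := by simp
  simp only [koszulInv] at h ⊢
  rw [h, hl]

theorem koszulInv_skew_right {f : Idx → Idx → V} (hf : ∀ I, IsSkew fun J => f I J) (I : Idx) :
    IsSkew fun J => koszulInv f I J :=
  koszulStage_skew_right hf I.length I

theorem koszulInv_spec {f : Idx → Idx → V} (hf : ∀ J, IsSkew fun I => f I J) (I J : Idx) :
    (2 : ℂ) • koszulInv f I J + koszulNumber (koszulInv f) I J = f I J := by
  rw [koszulNumber_eq (koszulInv_skew_left hf)]
  cases I with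
  | nil => simp [koszulInv, koszulStage, transfer, wedge, smul_smul]
  | cons i I =>
    have h : transfer (koszulInv f) (i :: I) J = transfer (koszulStage f I.length) (i :: I) J := by
      refine transfer_congr J fun K J hK => ?_
      rw [List.length_cons, add_left_inj] at hK
      rw [koszulInv, hK]
    have h3 : (I.length : ℂ) + 3 ≠ 0 := by norm_cast
    rw [h, add_sub_assoc', ← add_smul, koszulInv, List.length_cons, koszulStage, smul_smul]
    have h4 : (2 + ((I.length + 1 : ℕ) : ℂ)) * ((I.length : ℂ) + 3)⁻¹ = 1 := by
      push_cast
      rw [show (2 + ((I.length : ℂ) + 1)) = (I.length : ℂ) + 3 by ring, mul_inv_cancel₀ h3]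
    rw [h4, one_smul, add_sub_cancel_right]

/-- With f = (2 + n)g, moving the contraction past n turns 2 + n into 3 + n. -/
theorem contr_koszulInv {f : Idx → Idx → V} (hf : ∀ J, IsSkew fun I => f I J)
    (hf' : ∀ I, IsSkew fun J => f I J) (μ : Fin 4) (I J : Idx) :
    contr μ f I J = (3 : ℂ) • contr μ (koszulInv f) I J +
      koszulNumber (contr μ (koszulInv f)) I J := by
  have h : f = fun I J => (2 : ℂ) • koszulInv f I J + koszulNumber (koszulInv f) I J := by
    funext I J
    rw [koszulInv_spec hf]
  have h1 := contr_koszulNumber (koszulInv_skew_left hf) (koszulInv_skew_right hf') μ I J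
  conv_lhs => rw [h]
  have h2 : contr μ (fun I J => (2 : ℂ) • koszulInv f I J + koszulNumber (koszulInv f) I J) I J =
      (2 : ℂ) • contr μ (koszulInv f) I J + contr μ (koszulNumber (koszulInv f)) I J := by
    simp only [contr, smul_add, smul_sub, smul_comm (2 : ℂ)]
    abel
  rw [h2, h1, ← add_assoc, show (3 : ℂ) = 2 + 1 by norm_num, add_smul, one_smul]

/-- The homotopy applied to the solution of `(2 + n) g = f`. -/
def koszulPrimitive (f : Fin 4 → Fin 4 → Idx → Idx → V) : Fin 4 → Idx → Idx → V :=
  fun ν I J => wedge I fun ρ K => koszulInv (f ρ ν) K J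

/-- Exactness of the Koszul complex on quadratic elements. -/
theorem contr_koszulPrimitive {f : Fin 4 → Fin 4 → Idx → Idx → V}
    (hf : ∀ μ ν J, IsSkew fun I => f μ ν I J) (hf' : ∀ μ ν I, IsSkew fun J => f μ ν I J)
    (hsymm : ∀ μ ν, f μ ν = f ν μ)
    (hcycle : ∀ μ ν ρ I J, contr μ (f ν ρ) I J + contr ν (f μ ρ) I J + contr ρ (f μ ν) I J = 0)
    (μ ν : Fin 4) (I J : Idx) :
    contr μ (koszulPrimitive f ν) I J + contr ν (koszulPrimitive f μ) I J = f μ ν I J := by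
  set g := fun μ ν => koszulInv (f μ ν) with hg
  -- The inverse of 2 + n preserves cycles: 3 + n maps the boundary of g to that of f, which is
  -- zero, and 3 + n is injective (m = 2 below).
  have hgc (μ ν ρ : Fin 4) (I J : Idx) :
      contr μ (g ν ρ) I J + contr ν (g μ ρ) I J + contr ρ (g μ ν) I J = 0 := by
    have hk (a b c : Fin 4) (J : Idx) := contr_skew_left (koszulInv_skew_left (hf b c)) a J
    refine eq_zero_of_koszulNumber
      (f := fun I J => contr μ (g ν ρ) I J + contr ν (g μ ρ) I J + contr ρ (g μ ν) I J)
      (fun J => ((hk μ ν ρ J).add (hk ν μ ρ J)).add (hk ρ μ ν J)) 2 (fun I J => ?_) I J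
    have h := hcycle μ ν ρ I J
    rw [contr_koszulInv (hf ν ρ) (hf' ν ρ), contr_koszulInv (hf μ ρ) (hf' μ ρ),
      contr_koszulInv (hf μ ν) (hf' μ ν)] at h
    rw [← h]
    have e : koszulNumber (fun I J => contr μ (g ν ρ) I J + contr ν (g μ ρ) I J +
        contr ρ (g μ ν) I J) I J = koszulNumber (contr μ (g ν ρ)) I J +
        koszulNumber (contr ν (g μ ρ)) I J + koszulNumber (contr ρ (g μ ν)) I J := by
      simp only [koszulNumber]
      rw [← wedge_add, ← wedge_add]
      refine wedge_congr fun σ K _ => ?_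
      simp only [contr, smul_add]
      abel
    rw [e]
    norm_num only [smul_add]
    abel
  have h1 := contr_wedge μ (fun ρ => g ρ ν) I J
  have h2 := contr_wedge ν (fun ρ => g ρ μ) I J
  have h3 := koszulInv_spec (hf μ ν) I J
  -- By the cycle condition the two contractions with μ and ν add up to minus the one with ρ, which
  -- is summed against ε_ρ: this is where n appears.
  have h4 : wedge I (fun ρ K => contr μ (g ρ ν) K J) + wedge I (fun ρ K => contr ν (g ρ μ) K J) =
      -koszulNumber (g μ ν) I J := by
    rw [koszulNumber, ← wedge_neg, ← wedge_add]
    refine wedge_congr fun ρ K _ => ?_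
    have h5 := hgc μ ν ρ K J
    have s1 : g ρ ν = g ν ρ := by rw [hg]; simp only; rw [hsymm]
    have s2 : g ρ μ = g μ ρ := by rw [hg]; simp only; rw [hsymm]
    rw [s1, s2]
    exact eq_neg_of_add_eq_zero_left h5
  have s3 : g ν μ = g μ ν := by rw [hg]; simp only; rw [hsymm]
  rw [s3] at h2
  calc _ = (g μ ν I J - wedge I fun ρ K => contr μ (g ρ ν) K J) +
        (g μ ν I J - wedge I fun ρ K => contr ν (g ρ μ) K J) := congrArg₂ _ h1 h2
    _ = (2 : ℂ) • g μ ν I J - (wedge I (fun ρ K => contr μ (g ρ ν) K J) +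
        wedge I (fun ρ K => contr ν (g ρ μ) K J)) := by rw [two_smul]; abel
    _ = _ := by rw [h4, sub_neg_eq_add]; exact h3

end koszul

/-! ### Lorentz action on multi-indices -/

section tensorAct

variable {V : Type*} [AddCommGroup V] [Module ℂ V] (Λ : Matrix (Fin 4) (Fin 4) ℝ)

theorem tensorAct_congr {I : Idx} {f g : Idx → V} (h : ∀ K, K.length = I.length → f K = g K) :
    tensorAct Λ I f = tensorAct Λ I g := by
  induction I generalizing f g with
  | nil => exact h [] rfl
  | cons i I ih =>
    simp only [tensorAct]
    refine Finset.sum_congr rfl fun α _ => ?_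
    rw [ih fun K hK => h (α :: K) (by simp [hK])]

theorem map_tensorAct {W : Type*} [AddCommGroup W] [Module ℂ W] (φ : V →ₗ[ℂ] W) (I : Idx)
    (f : Idx → V) : φ (tensorAct Λ I f) = tensorAct Λ I fun K => φ (f K) := by
  induction I generalizing f with
  | nil => rfl
  | cons i I ih => simp only [tensorAct, map_sum, map_smul, ih]

theorem tensorAct_smul (c : ℂ) (I : Idx) (f : Idx → V) :
    tensorAct Λ I (fun K => c • f K) = c • tensorAct Λ I f :=
  (map_tensorAct Λ (LinearMap.lsmul ℂ V c) I f).symm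

theorem tensorAct_add (I : Idx) (f g : Idx → V) :
    tensorAct Λ I (fun K => f K + g K) = tensorAct Λ I f + tensorAct Λ I g := by
  induction I generalizing f g with
  | nil => rfl
  | cons i I ih => simp only [tensorAct, ih, smul_add, Finset.sum_add_distrib]

theorem tensorAct_zero (I : Idx) : tensorAct Λ I (fun _ => (0 : V)) = 0 := by
  simpa using tensorAct_smul Λ (0 : ℂ) I fun _ => (0 : V)

theorem tensorAct_sub (I : Idx) (f g : Idx → V) :
    tensorAct Λ I (fun K => f K - g K) = tensorAct Λ I f - tensorAct Λ I g := by
  have h := tensorAct_smul Λ (-1 : ℂ) I g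
  simp only [neg_smul, one_smul] at h
  simp only [sub_eq_add_neg, tensorAct_add, h]

theorem tensorAct_sum {ι : Type*} (s : Finset ι) (I : Idx) (f : ι → Idx → V) :
    tensorAct Λ I (fun K => ∑ i ∈ s, f i K) = ∑ i ∈ s, tensorAct Λ I (f i) := by
  classical
  induction s using Finset.induction_on with
  | empty => simp [tensorAct_zero]
  | insert a s ha ih => simp only [Finset.sum_insert ha, tensorAct_add, ih]

theorem tensorAct_comm (I J : Idx) (f : Idx → Idx → V) :
    tensorAct Λ I (fun I' => tensorAct Λ J fun J' => f I' J') =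
      tensorAct Λ J fun J' => tensorAct Λ I fun I' => f I' J' := by
  induction I generalizing f with
  | nil => rfl
  | cons i I ih => simp only [tensorAct, ih, tensorAct_sum, tensorAct_smul]

theorem tensorAct_append (I J : Idx) (f : Idx → V) :
    tensorAct Λ (I ++ J) f = tensorAct Λ I fun I' => tensorAct Λ J fun J' => f (I' ++ J') := by
  induction I generalizing f with
  | nil => rfl
  | cons i I ih => simp only [List.cons_append, tensorAct, ih]

theorem tensorAct_append_singleton (I : Idx) (μ : Fin 4) (f : Idx → V) :
    tensorAct Λ (I ++ [μ]) f = ∑ α, (Λ μ α : ℂ) • tensorAct Λ I fun I' => f (I' ++ [α]) := by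
  simp only [tensorAct_append, tensorAct, tensorAct_sum, tensorAct_smul]

theorem tensorAct_reverse (I : Idx) (f : Idx → V) :
    tensorAct Λ I.reverse f = tensorAct Λ I fun I' => f I'.reverse := by
  induction I generalizing f with
  | nil => rfl
  | cons i I ih =>
    simp only [List.reverse_cons, tensorAct_append_singleton, tensorAct, ih]

/-- Exterior multiplication is covariant: the index that it inserts into I transforms like the
vector index of G. -/
theorem tensorAct_wedge (I : Idx) (G : Fin 4 → Idx → V) :
    tensorAct Λ I (fun K => wedge K G) =
      wedge I fun μ K => ∑ α, (Λ μ α : ℂ) • tensorAct Λ K (G α) := by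
  induction I generalizing G with
  | nil => rfl
  | cons i I ih =>
    simp only [tensorAct, wedge, tensorAct_sub, ih, smul_sub, Finset.sum_sub_distrib]
    congr 1
    rw [Finset.sum_congr rfl fun α _ => (wedge_smul (Λ i α : ℂ) I _).symm, ← wedge_sum]
    refine wedge_congr fun μ K _ => ?_
    simp only [Finset.smul_sum]
    rw [Finset.sum_comm]
    refine Finset.sum_congr rfl fun β _ => Finset.sum_congr rfl fun α _ => ?_
    rw [smul_comm]

theorem tensorAct_wedge_param (I J : Idx) (F : Idx → Fin 4 → Idx → V) :
    tensorAct Λ J (fun J' => wedge I (F J')) =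
      wedge I fun μ K => tensorAct Λ J fun J' => F J' μ K := by
  induction J generalizing F with
  | nil => rfl
  | cons j J ih => simp only [tensorAct, ih, wedge_sum, wedge_smul]

theorem map_wedge_covariant {W : Type*} [AddCommGroup W] [Module ℂ W] (φ : W →ₗ[ℂ] V) (I : Idx)
    {F : Fin 4 → Idx → W} {G : Fin 4 → Idx → V}
    (h : ∀ μ K, K.length + 1 = I.length →
      φ (F μ K) = ∑ α, (Λ μ α : ℂ) • tensorAct Λ K (G α)) :
    φ (wedge I F) = tensorAct Λ I fun K => wedge K G := by
  rw [map_wedge, tensorAct_wedge]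
  exact wedge_congr h

end tensorAct

theorem sum_low_mul {Λ : Matrix (Fin 4) (Fin 4) ℝ} (hΛ : IsLorentz Λ) (α β : Fin 4) :
    ∑ ρ, (low Λ ρ α * Λ ρ β : ℂ) = if α = β then 1 else 0 := by
  have h := congrFun (congrFun (low_transpose_mul hΛ) α) β
  rw [Matrix.mul_apply, Matrix.one_apply] at h
  simp only [Matrix.transpose_apply] at h
  have h' := congrArg (fun x : ℝ => (x : ℂ)) h
  push_cast at h'
  rw [h']
  split_ifs <;> simp

/-- The divergence of a covariant vector is invariant. -/
theorem lorentz_div {Λ : Matrix (Fin 4) (Fin 4) ℝ} (hΛ : IsLorentz Λ) {f g : Fin 4 → Alg}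
    (h : ∀ ρ, lorentz Λ hΛ (f ρ) = ∑ β, (Λ ρ β : ℂ) • g β) :
    lorentz Λ hΛ (∑ ρ, d ρ (f ρ)) = ∑ ρ, d ρ (g ρ) := by
  simp only [map_sum, lorentz_d, h, map_smul, Finset.smul_sum, smul_smul]
  rw [Finset.sum_comm]
  refine Finset.sum_congr rfl fun α _ => ?_
  rw [Finset.sum_comm]
  simp only [← Finset.sum_smul, sum_low_mul hΛ, ite_smul, one_smul, zero_smul,
    Finset.sum_ite_eq, Finset.mem_univ, if_true]

/-! ### Covariant families -/

/-- Families `f(I, J, K)` of Wick polynomials, skew in `I` and in `J`, Lorentz covariant, of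
degrees in `D`, ghost number `g + |I| + |J|` and canonical dimension at most `w - |K|`. -/
structure IsFamily (D : Set ℕ) (g w : ℤ) (f : Idx → Idx → Idx → Alg) : Prop where
  skew_left : ∀ J K, IsSkew fun I => f I J K
  skew_right : ∀ I K, IsSkew fun J => f I J K
  mem : ∀ I J K : Idx, f I J K ∈ polys D (g + I.length + J.length) (w - K.length)
  cov : ∀ (Λ : Matrix (Fin 4) (Fin 4) ℝ) (hΛ : IsLorentz Λ) (I J K : Idx),
    lorentz Λ hΛ (f I J K) = tensorAct Λ I fun I' => tensorAct Λ J fun J' =>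
      tensorAct Λ K fun K' => f I' J' K'

namespace IsFamily

variable {D : Set ℕ} {g w : ℤ} {f f' : Idx → Idx → Idx → Alg}

theorem add (hf : IsFamily D g w f) (hf' : IsFamily D g w f') :
    IsFamily D g w fun I J K => f I J K + f' I J K where
  skew_left J K := (hf.skew_left J K).add (hf'.skew_left J K)
  skew_right I K := (hf.skew_right I K).add (hf'.skew_right I K)
  mem I J K := Submodule.add_mem _ (hf.mem I J K) (hf'.mem I J K)
  cov Λ hΛ I J K := by simp only [map_add, hf.cov, hf'.cov, tensorAct_add]

/-- Signs and recursion denominators depend only on lengths, which neither transpositions nor the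
Lorentz action change. -/
theorem smul_length (hf : IsFamily D g w f) (c : ℕ → ℕ → ℕ → ℂ) :
    IsFamily D g w fun I J K => c I.length J.length K.length • f I J K where
  skew_left J K I I' μ ν := by
    have h := hf.skew_left J K I I' μ ν
    simp only at h
    simp [h]
  skew_right I K J J' μ ν := by
    have h := hf.skew_right I K J J' μ ν
    simp only at h
    simp [h]
  mem I J K := Submodule.smul_mem _ _ (hf.mem I J K)
  cov Λ hΛ I J K := by
    rw [map_smul, hf.cov, ← tensorAct_smul]
    refine tensorAct_congr Λ fun I' hI' => ?_
    rw [← tensorAct_smul]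
    refine tensorAct_congr Λ fun J' hJ' => ?_
    rw [← tensorAct_smul]
    refine tensorAct_congr Λ fun K' hK' => ?_
    rw [hI', hJ', hK']

theorem smul (hf : IsFamily D g w f) (c : ℂ) : IsFamily D g w fun I J K => c • f I J K :=
  hf.smul_length fun _ _ _ => c

theorem sub (hf : IsFamily D g w f) (hf' : IsFamily D g w f') :
    IsFamily D g w fun I J K => f I J K - f' I J K := by
  simpa [sub_eq_add_neg] using hf.add (hf'.smul (-1))

theorem swap (hf : IsFamily D g w f) : IsFamily D g w fun I J K => f J I K where
  skew_left J K := hf.skew_right J K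
  skew_right I K := hf.skew_left I K
  mem I J K := by simpa only [add_right_comm] using hf.mem J I K
  cov Λ hΛ I J K := by rw [hf.cov, tensorAct_comm]

theorem reverse_tensor (hf : IsFamily D g w f) : IsFamily D g w fun I J K => f I J K.reverse where
  skew_left J K := hf.skew_left J _
  skew_right I K := hf.skew_right I _
  mem I J K := by simpa using hf.mem I J K.reverse
  cov Λ hΛ I J K := by simp only [hf.cov, tensorAct_reverse]

theorem _root_.CausalGravity.IsSkew.reverse {V : Type*} [AddCommGroup V] {f : Idx → V}
    (hf : IsSkew f) : IsSkew fun I => f I.reverse := fun I I' μ ν => by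
  have h := hf I'.reverse I.reverse ν μ
  simpa using h

theorem reverse (hf : IsFamily D g w f) :
    IsFamily D g w fun I J K => f I.reverse J.reverse K where
  skew_left J K := (hf.skew_left _ K).reverse
  skew_right I K := (hf.skew_right _ K).reverse
  mem I J K := by simpa using hf.mem I.reverse J.reverse K
  cov Λ hΛ I J K := by simp only [hf.cov, tensorAct_reverse]

theorem gauge (hf : IsFamily D g w f) :
    IsFamily D (g + 1) (w + 1) fun I J K => dQ (f I J K) where
  skew_left J K I I' μ ν := by
    have h := hf.skew_left J K I I' μ ν
    simp only at h
    simp [h]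
  skew_right I K J J' μ ν := by
    have h := hf.skew_right I K J J' μ ν
    simp only at h
    simp [h]
  mem I J K := dQ_mem_polys (hf.mem I J K) (by ring) (by linarith)
  cov Λ hΛ I J K := by simp only [lorentz_dQ, hf.cov, map_tensorAct]

theorem div_right (hf : IsFamily D g w f) :
    IsFamily D (g + 1) (w + 1) fun I J K => ∑ ρ, d ρ (f I (J ++ [ρ]) K) where
  skew_left J K I I' μ ν := by
    have h (ρ : Fin 4) := hf.skew_left (J ++ [ρ]) K I I' μ ν
    simp only at h
    simp [h]
  skew_right I K J J' μ ν := by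
    have h (ρ : Fin 4) := hf.skew_right I K J (J' ++ [ρ]) μ ν
    simp only at h
    simp [h]
  mem I J K := Submodule.sum_mem _ fun ρ _ => d_mem_polys ρ (hf.mem I (J ++ [ρ]) K)
    (by simp; ring) (by linarith)
  cov Λ hΛ I J K := by
    rw [lorentz_div hΛ (g := fun β => tensorAct Λ I fun I' => tensorAct Λ J fun J' =>
      tensorAct Λ K fun K' => f I' (J' ++ [β]) K')]
    · simp only [map_tensorAct, tensorAct_sum]
    · intro ρ
      simp only [hf.cov, tensorAct_append_singleton, tensorAct_sum, tensorAct_smul]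

theorem div_tensor (hf : IsFamily D g w f) :
    IsFamily D g w fun I J K => ∑ ρ, d ρ (f I J (ρ :: K)) where
  skew_left J K I I' μ ν := by
    have h (ρ : Fin 4) := hf.skew_left J (ρ :: K) I I' μ ν
    simp only at h
    simp [h]
  skew_right I K J J' μ ν := by
    have h (ρ : Fin 4) := hf.skew_right I (ρ :: K) J J' μ ν
    simp only at h
    simp [h]
  mem I J K := Submodule.sum_mem _ fun ρ _ => d_mem_polys ρ (hf.mem I J (ρ :: K))
    rfl (by simp)
  cov Λ hΛ I J K := by
    rw [lorentz_div hΛ (g := fun β => tensorAct Λ I fun I' => tensorAct Λ J fun J' =>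
      tensorAct Λ K fun K' => f I' J' (β :: K'))]
    · simp only [map_tensorAct, tensorAct_sum]
    · intro ρ
      simp only [hf.cov, tensorAct, tensorAct_sum, tensorAct_smul]

/-- The index `μ` of `K = μ K'` is moved to the end of `I`. -/
def shiftLeft (f : Idx → Idx → Idx → Alg) (I J : Idx) : Idx → Alg
  | [] => 0
  | μ :: K => f (I ++ [μ]) J K

/-- The index `μ` of `K = μ K'` is moved to the end of `J`. -/
def shiftRight (f : Idx → Idx → Idx → Alg) (I J : Idx) : Idx → Alg
  | [] => 0
  | μ :: K => f I (J ++ [μ]) K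

/-- One index passes from the derivatives of δ to I, so relative to the lengths of the new
multi-indices both the ghost number and the dimension bound rise by one. -/
theorem shift_left (hf : IsFamily D g w f) : IsFamily D (g + 1) (w + 1) (shiftLeft f) where
  skew_left J K I I' μ ν := by
    cases K with
    | nil => simp [shiftLeft]
    | cons ρ K => simpa [shiftLeft] using hf.skew_left J K I (I' ++ [ρ]) μ ν
  skew_right I K J J' μ ν := by
    cases K with
    | nil => simp [shiftLeft]
    | cons ρ K => simpa [shiftLeft] using hf.skew_right (I ++ [ρ]) K J J' μ ν
  mem I J K := by
    cases K with
    | nil => exact Submodule.zero_mem _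
    | cons ρ K =>
      have h := hf.mem (I ++ [ρ]) J K
      rw [shiftLeft]
      convert h using 1
      simp only [List.length_append, List.length_cons, List.length_nil]
      push_cast
      congr 1 <;> ring
  cov Λ hΛ I J K := by
    cases K with
    | nil => simp [shiftLeft, tensorAct, tensorAct_zero]
    | cons ρ K =>
      simp only [shiftLeft, hf.cov, tensorAct_append_singleton, tensorAct, tensorAct_sum,
        tensorAct_smul]

theorem shift_right (hf : IsFamily D g w f) : IsFamily D (g + 1) (w + 1) (shiftRight f) := by
  have h : shiftRight f = fun I J K => shiftLeft (fun I J K => f J I K) J I K := by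
    funext I J K
    cases K <;> rfl
  rw [h]
  exact hf.swap.shift_left.swap

theorem restrict (hf : IsFamily D g w f) (r : ℕ) :
    IsFamily D g w fun I J K => if K.length = r then f I J K else 0 := by
  simpa only [ite_smul, one_smul, zero_smul] using
    hf.smul_length fun _ _ k => if k = r then 1 else 0

theorem transfer (hf : IsFamily D g w f) :
    IsFamily D g w fun I J K => CausalGravity.transfer (fun I J => f I J K) I J where
  skew_left J K := transfer_skew_left (fun J => hf.skew_left J K) J
  skew_right I K := transfer_skew_right (fun I => hf.skew_right I K) I
  mem I J K := wedge_mem fun ρ I' hI' => by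
    have h := Submodule.smul_mem _ ((-1 : ℂ) ^ I'.length) (hf.mem I' (ρ :: J) K)
    convert h using 2
    rw [← hI', List.length_cons]
    push_cast
    ring
  cov Λ hΛ I J K := by
    have h := map_wedge_covariant Λ (lorentz Λ hΛ).toLinearMap I
      (F := fun ρ K₁ => (-1 : ℂ) ^ K₁.length • f K₁ (ρ :: J) K)
      (G := fun α I' => tensorAct Λ J fun J' => tensorAct Λ K fun K' =>
        (-1 : ℂ) ^ I'.length • f I' (α :: J') K') fun ρ I' _ => by
        simp only [AlgHom.toLinearMap_apply, map_smul, hf.cov, tensorAct, tensorAct_sum,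
          tensorAct_smul, Finset.smul_sum]
        refine Finset.sum_congr rfl fun α _ => ?_
        rw [smul_comm, ← tensorAct_smul]
        congr 1
        exact tensorAct_congr Λ fun I₂ hI₂ => by rw [hI₂]
    simp only [CausalGravity.transfer, tensorAct_wedge_param]
    exact h

/-- This is the homotopy. It absorbs a tensor index into I, the reverse of `shift_left`, and lowers
both bounds by one; hence B has type (g - 1, w - 1). -/
theorem wedge_tensor (hf : IsFamily D g w f) :
    IsFamily D (g - 1) (w - 1) fun I J K => wedge I fun ρ K₁ => f K₁ J (ρ :: K) where
  skew_left J K := wedge_skew fun ρ => hf.skew_left J (ρ :: K)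
  skew_right I K J J' μ ν := by
    beta_reduce
    rw [← wedge_neg]
    exact wedge_congr fun ρ I' _ => hf.skew_right I' (ρ :: K) J J' μ ν
  mem I J K := wedge_mem fun ρ I' hI' => by
    have h := hf.mem I' J (ρ :: K)
    convert h using 1
    rw [← hI', List.length_cons]
    push_cast
    congr 1 <;> ring
  cov Λ hΛ I J K := by
    have h := map_wedge_covariant Λ (lorentz Λ hΛ).toLinearMap I
      (F := fun ρ K₁ => f K₁ J (ρ :: K))
      (G := fun α I' => tensorAct Λ J fun J' => tensorAct Λ K fun K' => f I' J' (α :: K'))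
      fun ρ I' _ => by
        simp only [AlgHom.toLinearMap_apply, hf.cov, tensorAct, tensorAct_sum, tensorAct_smul]
    simp only [tensorAct_wedge_param]
    exact h

theorem stage (hf : IsFamily D g w f) (k : ℕ) :
    IsFamily D g w fun I J K => koszulStage (fun I J => f I J K) k I J := by
  induction k with
  | zero => exact hf.smul _
  | succ k ih => exact (hf.add ih.transfer).smul _

theorem inv (hf : IsFamily D g w f) :
    IsFamily D g w fun I J K => koszulInv (fun I J => f I J K) I J where
  skew_left J K := koszulInv_skew_left (fun J => hf.skew_left J K) J
  skew_right I K := koszulInv_skew_right (fun I => hf.skew_right I K) I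
  mem I J K := (hf.stage I.length).mem I J K
  cov Λ hΛ I J K := by
    simp only [koszulInv, (hf.stage I.length).cov]
    exact tensorAct_congr Λ fun I' hI' => by rw [hI']

end IsFamily

/-! ### Coefficients as families -/

/-- The coefficients of a cochain as one family indexed by `(I, J, K)`, where `K` collects the
derivatives of the delta function. -/
def Coeffs.family (c : Coeffs) (I J : Idx) : Idx → Alg
  | [] => c.N I J
  | [μ] => c.N₁ I J μ
  | [μ, ν] => c.N₂ I J μ ν
  | _ => 0

/-- The coefficients given by a family. -/
def Coeffs.ofFamily (f : Idx → Idx → Idx → Alg) : Coeffs where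
  N I J := f I J []
  N₁ I J μ := f I J [μ]
  N₂ I J μ ν := f I J [μ, ν]

theorem IsFamily.admissible {D : Set ℕ} {g w : ℤ} {f : Idx → Idx → Idx → Alg}
    (hf : IsFamily D g w f) (hs : ∀ I J μ ν, f I J [μ, ν] = f I J [ν, μ]) :
    (Coeffs.ofFamily f).Admissible D g w where
  skew_left J I I' μ ν := by
    refine Prod.ext (hf.skew_left J [] I I' μ ν) (Prod.ext ?_ ?_)
    · funext ρ
      exact hf.skew_left J [ρ] I I' μ ν
    · funext ρ σ
      exact hf.skew_left J [ρ, σ] I I' μ ν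
  skew_right J I I' μ ν := by
    refine Prod.ext (hf.skew_right J [] I I' μ ν) (Prod.ext ?_ ?_)
    · funext ρ
      exact hf.skew_right J [ρ] I I' μ ν
    · funext ρ σ
      exact hf.skew_right J [ρ, σ] I I' μ ν
  symm := hs
  mem I J := by simpa [Coeffs.ofFamily] using hf.mem I J []
  mem₁ I J μ := by simpa [Coeffs.ofFamily] using hf.mem I J [μ]
  mem₂ I J μ ν := by simpa [Coeffs.ofFamily] using hf.mem I J [μ, ν]
  cov Λ hΛ I J := hf.cov Λ hΛ I J []
  cov₁ Λ hΛ I J μ := hf.cov Λ hΛ I J [μ]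
  cov₂ Λ hΛ I J μ ν := by
    have h := hf.cov Λ hΛ I J [μ, ν]
    simpa only [Coeffs.ofFamily, tensorAct, Finset.smul_sum, smul_smul] using h

theorem Coeffs.Admissible.isFamily {D : Set ℕ} {g w : ℤ} {c : Coeffs} (hc : c.Admissible D g w) :
    IsFamily D g w c.family where
  skew_left J K I I' μ ν := by
    have h := hc.skew_left J I I' μ ν
    rcases K with _ | ⟨ρ, _ | ⟨σ, _ | ⟨τ, K⟩⟩⟩
    · exact congrArg Prod.fst h
    · exact congrArg (fun x => x.2.1 ρ) h
    · exact congrArg (fun x => x.2.2 ρ σ) h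
    · simp [Coeffs.family]
  skew_right J K I I' μ ν := by
    have h := hc.skew_right J I I' μ ν
    rcases K with _ | ⟨ρ, _ | ⟨σ, _ | ⟨τ, K⟩⟩⟩
    · exact congrArg Prod.fst h
    · exact congrArg (fun x => x.2.1 ρ) h
    · exact congrArg (fun x => x.2.2 ρ σ) h
    · simp [Coeffs.family]
  mem I J K := by
    rcases K with _ | ⟨ρ, _ | ⟨σ, _ | ⟨τ, K⟩⟩⟩
    · simpa [Coeffs.family] using hc.mem I J
    · simpa [Coeffs.family] using hc.mem₁ I J ρ
    · simpa [Coeffs.family] using hc.mem₂ I J ρ σ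
    · exact Submodule.zero_mem _
  cov Λ hΛ I J K := by
    rcases K with _ | ⟨ρ, _ | ⟨σ, _ | ⟨τ, K⟩⟩⟩
    · exact hc.cov Λ hΛ I J
    · exact hc.cov₁ Λ hΛ I J ρ
    · have h := hc.cov₂ Λ hΛ I J ρ σ
      simpa only [Coeffs.family, tensorAct, Finset.smul_sum, smul_smul] using h
    · simp [Coeffs.family, tensorAct, tensorAct_zero]

/-- The coefficients of `s̄ B` in terms of those of `B`. -/
def barFamily (f : Idx → Idx → Idx → Alg) (I J K : Idx) : Alg :=
  dQ (f I J K) + Complex.I • (IsFamily.shiftLeft f I J K +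
    (-1 : ℂ) ^ I.length • (∑ ρ, d ρ (f I (J ++ [ρ]) K) - IsFamily.shiftRight f I J K))

/-- Symmetrization in the indices of the derivatives of the delta function. -/
def symmFamily (f : Idx → Idx → Idx → Alg) (I J K : Idx) : Alg :=
  (2 : ℂ)⁻¹ • (f I J K + f I J K.reverse)

theorem IsFamily.bar {D : Set ℕ} {g w : ℤ} {f : Idx → Idx → Idx → Alg} (hf : IsFamily D g w f) :
    IsFamily D (g + 1) (w + 1) (barFamily f) :=
  hf.gauge.add ((hf.shift_left.add
    ((hf.div_right.sub hf.shift_right).smul_length fun p _ _ => (-1) ^ p)).smul _)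

theorem IsFamily.symmetrize {D : Set ℕ} {g w : ℤ} {f : Idx → Idx → Idx → Alg}
    (hf : IsFamily D g w f) : IsFamily D g w (symmFamily f) :=
  (hf.add hf.reverse_tensor).smul _

theorem symmFamily_symm (f : Idx → Idx → Idx → Alg) (I J : Idx) (μ ν : Fin 4) :
    symmFamily f I J [μ, ν] = symmFamily f I J [ν, μ] := by
  simp [symmFamily, add_comm]

/-- As ∂_μ∂_νδ is symmetric, the antisymmetric part of its coefficient is invisible. The
coefficients of s̄B need this symmetrization before they can be admissible. -/
theorem toCochain_ofFamily_symmFamily (f : Idx → Idx → Idx → Alg) :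
    (Coeffs.ofFamily (symmFamily f)).toCochain = (Coeffs.ofFamily f).toCochain := by
  have h2 (a : Alg) : (2 : ℂ)⁻¹ • (a + a) = a := by
    rw [← two_smul ℂ a, smul_smul]
    norm_num
  funext I J
  simp only [Coeffs.toCochain, Coeffs.ofFamily, symmFamily, List.reverse_nil,
    List.reverse_singleton, h2]
  congr 1
  simp only [List.reverse_cons, List.reverse_nil, List.nil_append, List.cons_append, map_smul,
    map_add, ← Finset.smul_sum, Finset.sum_add_distrib]
  have h : ∑ μ, ∑ ν, del1 μ (del1 ν (delta (f I J [ν, μ]))) =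
      ∑ μ, ∑ ν, del1 μ (del1 ν (delta (f I J [μ, ν]))) := by
    rw [Finset.sum_comm]
    exact Finset.sum_congr rfl fun μ _ => Finset.sum_congr rfl fun ν _ => del1_comm _ _ _
  rw [h, ← two_smul ℂ, smul_smul, inv_mul_cancel₀ two_ne_zero, one_smul]

/-- The absence of second derivatives in B ensures that s̄B has no third derivatives, which `Coeffs`
could not record. -/
theorem sBar_toCochain {b : Coeffs} (hb : ∀ I J μ ν, b.N₂ I J μ ν = 0) :
    sBar b.toCochain = (Coeffs.ofFamily (barFamily b.family)).toCochain := by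
  funext I J
  simp only [sBar, deltaOp, Coeffs.toCochain, Coeffs.ofFamily, barFamily, Coeffs.family, hb,
    IsFamily.shiftLeft, IsFamily.shiftRight, del2_apply, map_add, map_sum, map_smul, map_zero,
    map_sub, onCoeff_delta, onCoeff_del1, smul_add, smul_sub, Finset.smul_sum,
    Finset.sum_add_distrib, Finset.sum_sub_distrib,
    Finset.sum_const_zero, add_zero, smul_zero, zero_add, sub_zero]
  rw [Finset.sum_comm (f := fun x y =>
    Complex.I • (-1 : ℂ) ^ I.length • (del1 y) (delta ((d x) (b.N₁ I (J ++ [x]) y))))]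
  abel

/-! ### Nilpotency -/

theorem toCochain_skew_left {D : Set ℕ} {g w : ℤ} {c : Coeffs} (hc : c.Admissible D g w)
    (J : Idx) : IsSkew fun I => c.toCochain I J := by
  intro I I' μ ν
  have h := hc.skew_left J I I' μ ν
  simp only [Prod.mk.injEq, Prod.neg_mk] at h
  simp only [Coeffs.toCochain, h, Pi.neg_apply, map_neg, Finset.sum_neg_distrib]
  abel

theorem toCochain_skew_right {D : Set ℕ} {g w : ℤ} {c : Coeffs} (hc : c.Admissible D g w)
    (I : Idx) : IsSkew fun J => c.toCochain I J := by
  intro J J' μ ν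
  have h := hc.skew_right I J J' μ ν
  simp only [Prod.mk.injEq, Prod.neg_mk] at h
  simp only [Coeffs.toCochain, h, Pi.neg_apply, map_neg, Finset.sum_neg_distrib]
  abel

theorem sum_sum_eq_zero_of_skew {V : Type*} [AddCommGroup V] [Module ℂ V] {F : Fin 4 → Fin 4 → V}
    (h : ∀ μ ν, F μ ν = -F ν μ) : ∑ μ, ∑ ν, F μ ν = 0 := by
  have h1 : ∑ μ, ∑ ν, F μ ν = -∑ μ, ∑ ν, F μ ν := by
    conv_lhs => rw [Finset.sum_comm]
    rw [← Finset.sum_neg_distrib]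
    refine Finset.sum_congr rfl fun μ _ => ?_
    rw [← Finset.sum_neg_distrib]
    exact Finset.sum_congr rfl fun ν _ => h ν μ
  have h2 : (2 : ℂ) • ∑ μ, ∑ ν, F μ ν = 0 := by
    rw [two_smul]
    nth_rewrite 1 [h1]
    simp
  exact (smul_eq_zero.mp h2).resolve_left two_ne_zero

/-- The pure double derivatives are symmetric and meet skew indices; the two mixed terms have
opposite signs because the first divergence changes (-1)^{|I|}. -/
theorem deltaOp_deltaOp {R : Cochain} (hl : ∀ J, IsSkew fun I => R I J)
    (hr : ∀ I, IsSkew fun J => R I J) : deltaOp (deltaOp R) = 0 := by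
  funext I J
  have h1 : ∑ μ, ∑ ν, del1 μ (del1 ν (R (I ++ [μ] ++ [ν]) J)) = 0 := by
    refine sum_sum_eq_zero_of_skew fun μ ν => ?_
    have h := hl J I [] μ ν
    simp only at h
    rw [List.append_assoc, List.append_assoc, List.singleton_append, List.singleton_append, h,
      del1_comm μ ν, map_neg, map_neg]
  have h2 : ∑ μ, ∑ ν, del2 μ (del2 ν (R I (J ++ [μ] ++ [ν]))) = 0 := by
    refine sum_sum_eq_zero_of_skew fun μ ν => ?_
    have h := hr I J [] μ ν
    simp only at h
    rw [List.append_assoc, List.append_assoc, List.singleton_append, List.singleton_append, h,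
      del2_comm μ ν, map_neg, map_neg]
  have h3 : ∑ μ, ∑ ν, del1 μ (del2 ν (R (I ++ [μ]) (J ++ [ν]))) =
      ∑ ν, ∑ μ, del2 ν (del1 μ (R (I ++ [μ]) (J ++ [ν]))) := by
    rw [Finset.sum_comm]
    simp only [del1_del2]
  simp only [deltaOp, map_add, map_sum, map_smul, Finset.sum_add_distrib, ← Finset.smul_sum, h1, h2,
    smul_zero, zero_add, add_zero, List.length_append, List.length_singleton, pow_succ, mul_neg,
    mul_one, neg_smul, map_neg, Finset.sum_neg_distrib, h3, Pi.zero_apply, neg_add_cancel]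

theorem onCoeff_dQ_deltaOp (R : Cochain) (I J : Idx) :
    onCoeff dQ (deltaOp R I J) = deltaOp (fun I J => onCoeff dQ (R I J)) I J := by
  simp only [deltaOp, map_add, map_sum, map_smul, onCoeff_del1, onCoeff_dQ_del2]

theorem deltaOp_add_smul (R S : Cochain) (c : ℂ) (I J : Idx) :
    deltaOp (fun I J => R I J + c • S I J) I J = deltaOp R I J + c • deltaOp S I J := by
  simp only [deltaOp, map_add, map_smul, smul_add, Finset.sum_add_distrib, ← Finset.smul_sum,
    smul_comm c]
  abel

/-- d_Q commutes with δ instead of anticommuting, so the opposite signs in s and s̄ are what makes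
the mixed terms cancel. -/
theorem sOp_sBar {B : Cochain} (hl : ∀ J, IsSkew fun I => B I J)
    (hr : ∀ I, IsSkew fun J => B I J) : sOp (sBar B) = 0 := by
  funext I J
  have h : deltaOp (sBar B) I J = deltaOp (fun I J => onCoeff dQ (B I J)) I J +
      Complex.I • deltaOp (deltaOp B) I J := deltaOp_add_smul _ _ _ I J
  rw [sOp, h, deltaOp_deltaOp hl hr, ← onCoeff_dQ_deltaOp, sBar, map_add, onCoeff_dQ_dQ, map_smul]
  simp

theorem sOp_sub (R S : Cochain) : sOp (R - S) = sOp R - sOp S := by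
  funext I J
  have h := deltaOp_add_smul R S (-1) I J
  simp only [neg_smul, one_smul, ← sub_eq_add_neg] at h
  have h' : deltaOp (R - S) I J = deltaOp R I J - deltaOp S I J := h
  simp only [sOp, h', Pi.sub_apply, map_sub, smul_sub]
  abel

/-! ### The leading coefficients of a cocycle -/

theorem lower_lower_toCochain (c : Coeffs) (I J : Idx) (α β : Fin 4) :
    lower α (lower β (c.toCochain I J)) = delta (c.N₂ I J α β + c.N₂ I J β α) := by
  simp only [Coeffs.toCochain, map_add, map_sum, lower_del1, lower_delta, apply_ite (lower α),
    map_zero, apply_ite (del1 _), add_zero, zero_add, Finset.sum_add_distrib, Finset.sum_ite_eq,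
    Finset.mem_univ, if_true]
  rw [Finset.sum_comm, add_comm]
  simp only [Finset.sum_ite_eq, Finset.mem_univ, if_true]

theorem deltaCoeff_lower_del1 (α β γ μ : Fin 4) (x : QuasiLocal) :
    deltaCoeff (lower α (lower β (lower γ (del1 μ x)))) =
      (if γ = μ then deltaCoeff (lower α (lower β x)) else 0) +
      (if β = μ then deltaCoeff (lower α (lower γ x)) else 0) +
      (if α = μ then deltaCoeff (lower β (lower γ x)) else 0) := by
  simp only [lower_del1, map_add, deltaCoeff_del1, apply_ite (lower α), apply_ite (lower β),
    apply_ite deltaCoeff, map_zero, add_zero]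
  abel

/-- The coefficient of the third derivatives of the delta function in `sR = 0`. -/
theorem cocycle_leading {c : Coeffs} (hsymm : ∀ I J μ ν, c.N₂ I J μ ν = c.N₂ I J ν μ)
    (hs : sOp c.toCochain = 0) (α β γ : Fin 4) (I J : Idx) :
    (c.N₂ (I ++ [α]) J β γ - (-1 : ℂ) ^ I.length • c.N₂ I (J ++ [α]) β γ) +
      (c.N₂ (I ++ [β]) J α γ - (-1 : ℂ) ^ I.length • c.N₂ I (J ++ [β]) α γ) +
      (c.N₂ (I ++ [γ]) J α β - (-1 : ℂ) ^ I.length • c.N₂ I (J ++ [γ]) α β) = 0 := by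
  have h2 (I J : Idx) (μ ν : Fin 4) : deltaCoeff (lower μ (lower ν (c.toCochain I J))) =
      (2 : ℂ) • c.N₂ I J μ ν := by
    rw [lower_lower_toCochain, deltaCoeff_delta, hsymm I J ν μ, two_smul]
  -- E differentiates three times with respect to ∂ and keeps the δ-term. It kills R with any
  -- operator applied to its coefficients, since the order there is at most two.
  set E := deltaCoeff ∘ₗ lower α ∘ₗ lower β ∘ₗ lower γ with hE
  have hE₁ (f : Alg →ₗ[ℂ] Alg) (I J : Idx) : E (onCoeff f (c.toCochain I J)) = 0 := by
    simp only [hE, LinearMap.comp_apply, lower_onCoeff, lower_lower_toCochain, lower_delta,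
      map_zero]
  have hE₂ (μ : Fin 4) (I J : Idx) : E (del1 μ (c.toCochain I J)) =
      (2 : ℂ) • ((if γ = μ then c.N₂ I J α β else 0) + (if β = μ then c.N₂ I J α γ else 0) +
        (if α = μ then c.N₂ I J β γ else 0)) := by
    simp only [hE, LinearMap.comp_apply, deltaCoeff_lower_del1, h2, smul_add, smul_ite, smul_zero]
  have h := congrArg E (congrFun (congrFun hs I) J)
  simp only [sOp, deltaOp, del2_apply, map_sub, map_add, map_smul, map_sum, hE₁, hE₂,
    ← Finset.smul_sum, Finset.sum_add_distrib, Finset.sum_sub_distrib, Finset.sum_ite_eq,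
    Finset.sum_const_zero, Finset.mem_univ, if_true, Pi.zero_apply, map_zero, zero_sub] at h
  -- The factor is -i from s times 2 from the second derivative of a symmetric quadratic form.
  have h' : (-2 * Complex.I) • ((c.N₂ (I ++ [α]) J β γ -
        (-1 : ℂ) ^ I.length • c.N₂ I (J ++ [α]) β γ) +
      (c.N₂ (I ++ [β]) J α γ - (-1 : ℂ) ^ I.length • c.N₂ I (J ++ [β]) α γ) +
      (c.N₂ (I ++ [γ]) J α β - (-1 : ℂ) ^ I.length • c.N₂ I (J ++ [γ]) α β)) = 0 := by
    rw [← h]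
    module
  exact (smul_eq_zero.mp h').resolve_left (by simp)

/-! ### The exchange of the two arguments of a cochain -/

/-- The exchange replaces ∂ by d - ∂, so differentiation with respect to ∂ changes sign. -/
theorem lower_exchange (α : Fin 4) (x : QuasiLocal) :
    lower α (exchange x) = -exchange (lower α x) := by
  induction x using QuasiLocal.induction_del1 with
  | zero => simp
  | add x y hx hy => simp only [map_add, hx, hy, neg_add]
  | hdelta W => simp only [exchange_delta, lower_delta, map_zero, neg_zero]
  | hdel μ x ih =>
    simp only [exchange_del1, lower_del1, del2_apply, map_sub, map_add, lower_onCoeff, ih, map_neg]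
    split_ifs <;> simp <;> abel

/-- The cochain `(I, J) ↦ (-1)^{|I||J|} R(T^J(x₂), T^I(x₁))`. -/
def flip (R : Cochain) : Cochain := fun I J => (-1 : ℂ) ^ (I.length * J.length) • exchange (R J I)

theorem isGradedSymmetric_iff (R : Cochain) : IsGradedSymmetric R ↔ flip R = R :=
  ⟨fun h => funext fun I => funext fun J => (h I J).symm,
    fun h I J => (congrFun (congrFun h I) J).symm⟩

theorem flip_add (R S : Cochain) : flip (R + S) = flip R + flip S := by
  funext I J
  simp [flip]

theorem flip_smul (c : ℂ) (R : Cochain) : flip (c • R) = c • flip R := by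
  funext I J
  simp [flip, smul_comm c]

theorem flip_sub (R S : Cochain) : flip (R - S) = flip R - flip S := by
  funext I J
  simp [flip, smul_sub]

theorem flip_flip (R : Cochain) : flip (flip R) = R := by
  funext I J
  rw [flip, flip, map_smul, exchange_exchange, smul_smul, mul_comm J.length, ← mul_pow]
  simp

theorem neg_one_pow_mul_self (n : ℕ) : (-1 : ℂ) ^ n * (-1) ^ n = 1 := by
  rw [← mul_pow]
  simp

/-- The exchange interchanges ∂^1 and ∂^2, and (-1)^{|I||J|} changes by (-1)^{|J|} or (-1)^{|I|}
when an index is appended; the two terms of δ are thereby swapped with the right signs. -/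
theorem sBar_flip (R : Cochain) : sBar (flip R) = flip (sBar R) := by
  funext I J
  have hI := neg_one_pow_mul_self I.length
  simp only [sBar, deltaOp, flip, map_add, map_smul, map_sum, exchange_onCoeff_dQ, exchange_del1,
    exchange_del2, List.length_append, List.length_singleton, add_mul, mul_add, one_mul, mul_one,
    pow_add, ← Finset.smul_sum, smul_smul]
  rw [mul_left_comm, hI]
  module

/-! ### Removal of the leading coefficients -/

theorem toCochain_ofFamily_sub (f f' : Idx → Idx → Idx → Alg) :
    (Coeffs.ofFamily fun I J K => f I J K - f' I J K).toCochain =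
      (Coeffs.ofFamily f).toCochain - (Coeffs.ofFamily f').toCochain := by
  funext I J
  simp only [Coeffs.toCochain, Coeffs.ofFamily, map_sub, Finset.sum_sub_distrib, Pi.sub_apply]
  abel

theorem toCochain_ofFamily_add (f f' : Idx → Idx → Idx → Alg) :
    (Coeffs.ofFamily fun I J K => f I J K + f' I J K).toCochain =
      (Coeffs.ofFamily f).toCochain + (Coeffs.ofFamily f').toCochain := by
  funext I J
  simp only [Coeffs.toCochain, Coeffs.ofFamily, map_add, Finset.sum_add_distrib, Pi.add_apply]
  abel

theorem toCochain_ofFamily_smul (c : ℂ) (f : Idx → Idx → Idx → Alg) :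
    (Coeffs.ofFamily fun I J K => c • f I J K).toCochain =
      c • (Coeffs.ofFamily f).toCochain := by
  funext I J
  simp only [Coeffs.toCochain, Coeffs.ofFamily, map_smul, Finset.smul_sum, smul_add,
    Pi.smul_apply]

/-- Only the derivatives that fall on δ in ∂_νδ B^ν reach second order. The factor i comes from s̄
and 1/2 from the symmetrization. -/
theorem symmFamily_barFamily {b : Coeffs} (hb : ∀ I J μ ν, b.N₂ I J μ ν = 0) (I J : Idx)
    (μ ν : Fin 4) : symmFamily (barFamily b.family) I J [μ, ν] = (Complex.I / 2) •
      ((b.N₁ (I ++ [μ]) J ν - (-1 : ℂ) ^ I.length • b.N₁ I (J ++ [μ]) ν) +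
        (b.N₁ (I ++ [ν]) J μ - (-1 : ℂ) ^ I.length • b.N₁ I (J ++ [ν]) μ)) := by
  simp only [symmFamily, barFamily, IsFamily.shiftLeft, IsFamily.shiftRight, Coeffs.family, hb,
    map_zero, Finset.sum_const_zero, List.reverse_cons, List.reverse_nil, List.nil_append,
    List.cons_append]
  module

/-- The leading coefficients of a cocycle are those of a coboundary. -/
theorem exists_leading_primitive {D : Set ℕ} {g w : ℤ} {c : Coeffs} (hc : c.Admissible D g w)
    (hs : sOp c.toCochain = 0) : ∃ b : Coeffs, b.Admissible D (g - 1) (w - 1) ∧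
      (∀ I J μ ν, b.N₂ I J μ ν = 0) ∧
      ∀ I J μ ν, c.N₂ I J μ ν = symmFamily (barFamily b.family) I J [μ, ν] := by
  -- The divergence appends an index at the end, whereas `contr` inserts it at the front; reversing
  -- the multi-indices reconciles the two.
  set f : Fin 4 → Fin 4 → Idx → Idx → Alg := fun μ ν I J => c.N₂ I.reverse J.reverse μ ν with hf
  have hfam := hc.isFamily.reverse
  -- The primitive is rescaled by -2i because (i/2)(-2i) = 1, and truncated to the coefficient of
  -- ∂_νδ.
  have hp := ((hfam.inv.wedge_tensor.reverse.smul (-2 * Complex.I)).restrict 1)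
  have hk := contr_koszulPrimitive (f := f) (fun μ ν J => hfam.skew_left J [μ, ν])
    (fun μ ν I => hfam.skew_right I [μ, ν])
    (fun μ ν => by funext I J; exact hc.symm _ _ _ _)
    (fun μ ν ρ I J => by
      have h := cocycle_leading hc.symm hs μ ν ρ I.reverse J.reverse
      simpa [contr, hf] using h)
  refine ⟨Coeffs.ofFamily _, hp.admissible (fun I J μ ν => by simp), fun I J μ ν => ?_,
    fun I J μ ν => ?_⟩
  · simp [Coeffs.ofFamily]
  · have h := hk μ ν I.reverse J.reverse
    rw [symmFamily_barFamily (fun I J μ ν => by simp [Coeffs.ofFamily])]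
    have e (ν : Fin 4) (I J : Idx) : (Coeffs.ofFamily fun I J K => if K.length = 1 then
        (-2 * Complex.I) • wedge I.reverse fun ρ K₁ =>
          koszulInv (fun I J => c.family I.reverse J.reverse (ρ :: K)) K₁ J.reverse
          else 0).N₁ I J ν =
        (-2 * Complex.I) • koszulPrimitive f ν I.reverse J.reverse := by
      simp [Coeffs.ofFamily, koszulPrimitive, hf, Coeffs.family]
    rw [e, e, e, e]
    simp only [contr, hf, List.reverse_reverse, List.length_reverse, List.reverse_append,
      List.reverse_singleton, List.singleton_append] at h ⊢
    rw [← h]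
    have hI : Complex.I / 2 * (-2 * Complex.I) = 1 := by
      linear_combination -Complex.I_mul_I
    match_scalars
    · linear_combination -hI
    · linear_combination (-1 : ℂ) ^ I.length * hI
    · linear_combination -hI
    · linear_combination (-1 : ℂ) ^ I.length * hI

/-- Subtraction of a coboundary with the same leading coefficients. -/
theorem exists_cohomologous {D : Set ℕ} {g w : ℤ} {c b : Coeffs} (hc : c.Admissible D g w)
    (hs : sOp c.toCochain = 0) (hb : b.Admissible D (g - 1) (w - 1))
    (hb₂ : ∀ I J μ ν, b.N₂ I J μ ν = 0)
    (h : ∀ I J μ ν, c.N₂ I J μ ν = symmFamily (barFamily b.family) I J [μ, ν]) :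
    ∃ c' : Coeffs, c'.Admissible D g w ∧ sOp c'.toCochain = 0 ∧
      (∀ I J μ ν, c'.N₂ I J μ ν = 0) ∧ c.toCochain - c'.toCochain = sBar b.toCochain := by
  -- s̄ raises the type (g - 1, w - 1) back to (g, w).
  have hfam := hb.isFamily.bar.symmetrize
  rw [sub_add_cancel, sub_add_cancel] at hfam
  have he : (Coeffs.ofFamily fun I J K => c.family I J K -
      symmFamily (barFamily b.family) I J K).toCochain = c.toCochain - sBar b.toCochain := by
    rw [toCochain_ofFamily_sub, toCochain_ofFamily_symmFamily, sBar_toCochain hb₂]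
    rfl
  refine ⟨_, (hc.isFamily.sub hfam).admissible fun I J μ ν => ?_, ?_, fun I J μ ν => ?_, ?_⟩
  · rw [symmFamily_symm]
    exact congrArg (· - _) (hc.symm I J μ ν)
  · rw [he, sOp_sub, hs, sOp_sBar (toCochain_skew_left hb) (toCochain_skew_right hb), sub_zero]
  · exact sub_eq_zero.mpr (h I J μ ν)
  · rw [he, sub_sub_cancel]

/-! ### Graded symmetry -/

/-- The coefficients of the flipped cochain. -/
def flipFamily (f : Idx → Idx → Idx → Alg) (I J K : Idx) : Alg :=
  (-1 : ℂ) ^ (I.length * J.length) •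
    ((-1 : ℂ) ^ K.length • f J I K + ∑ ρ, d ρ (f J I (ρ :: K)))

theorem IsFamily.flip {D : Set ℕ} {g w : ℤ} {f : Idx → Idx → Idx → Alg} (hf : IsFamily D g w f) :
    IsFamily D g w (flipFamily f) :=
  ((hf.swap.smul_length fun _ _ k => (-1) ^ k).add hf.swap.div_tensor).smul_length
    fun p q _ => (-1) ^ (p * q)

/-- The exchange sends ∂_ρδ W to δ d_ρW - ∂_ρδ W, whence the divergence in `flipFamily`. That
formula is right only up to first order in ∂. -/
theorem flip_toCochain {b : Coeffs} (hb : ∀ I J μ ν, b.N₂ I J μ ν = 0) :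
    (Coeffs.ofFamily (flipFamily b.family)).toCochain = flip b.toCochain := by
  funext I J
  simp only [flip, Coeffs.toCochain, Coeffs.ofFamily, flipFamily, Coeffs.family, hb, map_add,
    map_sum, map_smul, exchange_delta, exchange_del1, del2_apply, map_zero, onCoeff_delta,
    Finset.sum_const_zero, smul_zero, add_zero, List.length_nil, List.length_singleton, pow_zero,
    one_smul, pow_one, neg_smul, Finset.sum_sub_distrib, smul_add, smul_sub, Finset.smul_sum,
    smul_neg, map_neg, Finset.sum_neg_distrib]
  abel

/-- At top order the exchange only replaces each ∂ by -∂, and two such signs cancel. -/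
theorem N₂_flip {c : Coeffs} (hsymm : ∀ I J μ ν, c.N₂ I J μ ν = c.N₂ I J ν μ)
    (h : IsGradedSymmetric c.toCochain) (I J : Idx) (μ ν : Fin 4) :
    c.N₂ I J μ ν = (-1 : ℂ) ^ (I.length * J.length) • c.N₂ J I μ ν := by
  have h1 := congrArg (fun x => deltaCoeff (lower μ (lower ν x))) (h I J)
  simp only [map_smul, lower_exchange, map_neg, neg_neg, lower_lower_toCochain, exchange_delta,
    deltaCoeff_delta, hsymm _ _ ν μ, ← two_smul ℂ (c.N₂ _ _ _ _)] at h1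
  rw [smul_comm] at h1
  exact smul_right_injective Alg (two_ne_zero (α := ℂ)) h1

/-- Averaging a primitive over the exchange of the arguments. -/
theorem exists_symmetric_primitive {D : Set ℕ} {g w : ℤ} {c b : Coeffs}
    (hsymm : ∀ I J μ ν, c.N₂ I J μ ν = c.N₂ I J ν μ) (hb : b.Admissible D g w)
    (hb₂ : ∀ I J μ ν, b.N₂ I J μ ν = 0)
    (h : ∀ I J μ ν, c.N₂ I J μ ν = symmFamily (barFamily b.family) I J [μ, ν])
    (hgs : IsGradedSymmetric c.toCochain) : ∃ b' : Coeffs, b'.Admissible D g w ∧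
      (∀ I J μ ν, b'.N₂ I J μ ν = 0) ∧
      (∀ I J μ ν, c.N₂ I J μ ν = symmFamily (barFamily b'.family) I J [μ, ν]) ∧
      IsGradedSymmetric b'.toCochain := by
  have hz (I J : Idx) (μ ν : Fin 4) :
      (2 : ℂ)⁻¹ • (b.family I J [μ, ν] + flipFamily b.family I J [μ, ν]) = 0 := by
    simp [flipFamily, Coeffs.family, hb₂]
  refine ⟨_, ((hb.isFamily.add hb.isFamily.flip).smul (2 : ℂ)⁻¹).admissible
    fun I J μ ν => by rw [hz, hz], hz, fun I J μ ν => ?_, ?_⟩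
  · have e (I J : Idx) (μ : Fin 4) : (Coeffs.ofFamily fun I J K => (2 : ℂ)⁻¹ •
        (b.family I J K + flipFamily b.family I J K)).N₁ I J μ =
        (2 : ℂ)⁻¹ • (b.N₁ I J μ - (-1 : ℂ) ^ (I.length * J.length) • b.N₁ J I μ) := by
      simp [Coeffs.ofFamily, flipFamily, Coeffs.family, hb₂, sub_eq_add_neg]
    -- By its symmetry the leading coefficient of R is its own average over the flip, so it matches
    -- that of s̄ applied to the averaged B.
    have h1 : c.N₂ I J μ ν = (2 : ℂ)⁻¹ •
        (c.N₂ I J μ ν + (-1 : ℂ) ^ (I.length * J.length) • c.N₂ J I μ ν) := by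
      rw [← N₂_flip hsymm hgs, ← two_smul ℂ, smul_smul, inv_mul_cancel₀ two_ne_zero, one_smul]
    have hI := neg_one_pow_mul_self I.length
    rw [h1, h I J, h J I, symmFamily_barFamily hb₂, symmFamily_barFamily hb₂,
      symmFamily_barFamily hz]
    simp only [e, List.length_append, List.length_singleton, add_mul, mul_add, one_mul, mul_one,
      pow_add]
    match_scalars <;> first
      | ring1
      | linear_combination (-(Complex.I * (-1 : ℂ) ^ (I.length * J.length) / 4)) * hI
  · rw [isGradedSymmetric_iff, toCochain_ofFamily_smul, toCochain_ofFamily_add, flip_toCochain hb₂,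
      flip_smul, flip_add, flip_flip, add_comm]
    rfl

end

end CausalGravity

/-! ### Conclusion -/

theorem mainTheorem5 (D : Set ℕ) (c : Coeffs) (hc : c.Admissible D 0 6)
    (hs : sOp c.toCochain = 0) :
    ∃ c' b : Coeffs,
      c'.Admissible D 0 6 ∧ sOp c'.toCochain = 0 ∧
      (∀ I J μ ν, c'.N₂ I J μ ν = 0) ∧
      b.Admissible D (-1) 5 ∧ (∀ I J μ ν, b.N₂ I J μ ν = 0) ∧
      c.toCochain - c'.toCochain = sBar b.toCochain ∧
      (IsGradedSymmetric c.toCochain →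
        IsGradedSymmetric c'.toCochain ∧ IsGradedSymmetric b.toCochain) := by
  obtain ⟨b, hb, hb₂, h⟩ := exists_leading_primitive hc hs
  -- The same B must also witness the symmetric clause, so it is averaged exactly when R is
  -- symmetric.
  by_cases hgs : IsGradedSymmetric c.toCochain
  · obtain ⟨b', hb', hb₂', h', hgs'⟩ := exists_symmetric_primitive hc.symm hb hb₂ h hgs
    obtain ⟨c', hc', hs', h₂', he⟩ := exists_cohomologous hc hs hb' hb₂' h'
    refine ⟨c', b', hc', hs', h₂', by simpa using hb', hb₂', he, fun _ => ⟨?_, hgs'⟩⟩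
    rw [isGradedSymmetric_iff] at hgs hgs' ⊢
    -- R' = R - s̄B inherits the symmetry, since the flip is linear and commutes with s̄.
    rw [← sub_sub_cancel c.toCochain c'.toCochain, he, flip_sub, ← sBar_flip, hgs, hgs']
  · obtain ⟨c', hc', hs', h₂', he⟩ := exists_cohomologous hc hs hb hb₂ h
    exact ⟨c', b, hc', hs', h₂', by simpa using hb, hb₂, he, fun hg => absurd hg hgs⟩
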